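/- **Setting.** Let $D\in\mathbb{N}$ and let $X\subseteq\mathbb{R}^D$ be recursively open, i.e. $X=\bigcup_m B_m$ for a computable sequence $(B_m)$ of open rational balls (the empty ball is allowed). Computability and continuity are those of Type-2 machines with respect to representations by infinite strings in $\{0,1\}^\omega$: for representations $\alpha,\beta$, a function is $(\alpha\to\beta)$-computable (continuous) if some computable (continuous) partial string function, called a realization of it, maps every $\alpha$-name of every argument to a $\beta$-name of the value. $\eta^{\omega\omega}$ is the standard representation of the continuous partial string functions with $G_\delta$ domain. Rational data are coded by infinite strings in a standard way, and the following representations are used. * $\rho$: a name of $x\in X$ is a sequence of rational vectors $q_m$ with $|x_i-q_{m,i}|\le 2^{-m}$ for all coordinates $i$ and all $m$. * $\rho_<^{(d)}$, $d\ge 0$: a name of $y\in\mathbb{R}$ is a rational sequence $(p_n)$ with $y=\sup_{n_0}\inf_{n_1}\sup_{n_2}\cdots\, p_{\langle n_0,\ldots,n_d\rangle}$ ($d+1$ alternating operators, intermediate values in $[-\infty,\infty]$). $\rho_>$: a name of $y\in\mathbb{R}$ is a rational sequence $(p_n)$ with $y=\inf_n p_n$. * $\mathbf{\Sigma}_1(X)$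 is the class of open subsets of $X$, and $\mathbf{\Sigma}_{d+1}(X)$ the class of sets $\bigcup_m (X\setminus S_m)$ with $S_m\in\mathbf{\Sigma}_d(X)$. A $\delta_{\mathbf{\Sigma}_1}$-name of $U\in\mathbf{\Sigma}_1(X)$ is a sequence of open rational balls with union $U$; a $\delta_{\mathbf{\Sigma}_{d+1}}$-name of $S\in\mathbf{\Sigma}_{d+1}(X)$ is the join of $\delta_{\mathbf{\Sigma}_d}$-names of sets $S_m$ with $S=\bigcup_m(X\setminus S_m)$. * For $d\ge 1$, $f:X\to\mathbb{R}$ is $\mathbf{\Sigma}_d$-lowersemimeasurable if $f^{-1}[(y,\infty)]\in\mathbf{\Sigma}_d(X)$ for all $y\in\mathbb{R}$, and effectively so if moreover $y\mapsto f^{-1}[(y,\infty)]$ is $(\rho_>\to\delta_{\mathbf{\Sigma}_d})$-computable. * $[\rho\to\rho_<^{(d)}]$, $d\ge 0$: a name of a $\mathbf{\Sigma}_{d+1}$-lowersemimeasurable $f:X\to\mathbb{R}$ is the join of $\delta_{\mathbf{\Sigma}_{d+1}}$-names of the sets $f^{-1}[(y,\infty)]$, $y\in\mathbb{Q}$. **Theorem.**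 (a) For every $d\ge 1$, the uniform characteristic function $\mathbf{\Sigma}_d(X)\times X\to\{0,1\}\subset\mathbb{R}$, $(S,x)\mapsto 1$ if $x\in S$ and $0$ if $x\notin S$, is $(\delta_{\mathbf{\Sigma}_d}\times\rho\to\rho_<^{(d-1)})$-computable. (b) For every $d\ge 0$, the apply operator $(f,x)\mapsto f(x)$ of $\mathbf{\Sigma}_{d+1}$-lowersemimeasurable functions $f:X\to\mathbb{R}$ and points $x\in X$ is $([\rho\to\rho_<^{(d)}]\times\rho\to\rho_<^{(d)})$-computable. (c) For every $d\ge 0$: every $(\rho\to\rho_<^{(d)})$-continuous $f:X\to\mathbb{R}$ is $\mathbf{\Sigma}_{d+1}$-lowersemimeasurable; every $(\rho\to\rho_<^{(d)})$-computable $f:X\to\mathbb{R}$ is effectively $\mathbf{\Sigma}_{d+1}$-lowersemimeasurable; and this holds uniformly in $f$: a single Type-2 machine maps every $\eta^{\omega\omega}$-name of a $(\rho\to\rho_<^{(d)})$-realization of a function $f:X\to\mathbb{R}$, together with every $\rho_>$-name of a $y\in\mathbb{R}$, to a $\delta_{\mathbf{\Sigma}_{d+1}}$-name of $f^{-1}[(y,\infty)]$.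 -/

import Mathlib

noncomputable section

namespace HyperSemi

/-! ### Cantor space, Type-2 machines -/

/-- Cantor space, with the product topology. -/
abbrev Cantor : Type := ℕ → Bool

/-- The pairing `⟨p, q⟩ = p₀ q₀ p₁ q₁ …` of infinite strings. -/
def pairStr (p q : Cantor) : Cantor := fun n => if n % 2 = 0 then p (n / 2) else q (n / 2)

/-- Component `m` of an infinite string read as the join `⟨p₀, p₁, …⟩` of countably many infinite
strings, where `⟨p₀, p₁, …⟩ ⟨m, k⟩ = pₘ k`. -/
def component (p : Cantor) (m : ℕ) : Cantor := fun k => p (Nat.pair m k)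

/-- The Type-2 machine with program `c`: to find the symbol number `k` of its output on the
infinite input `q`, it runs `c` on `(w, k)` for all finite prefixes `w` of `q`, in a dovetailed
manner: in phase `t = ⟨n, s⟩` for `s` steps on the prefix of length `n`. The first answer is taken
and never revised; before it the machine has read only finitely many symbols of `q`. -/
def machineSymbol (c : Nat.Partrec.Code) (q : Cantor) (k : ℕ) : Part ℕ :=
  Nat.rfindOpt fun t =>
    c.evaln t.unpair.2 (Nat.pair (Encodable.encode ((List.range t.unpair.1).map q)) k)

/-- The machine with program `c` on input `q` outputs the infinite string `r`. For given `c` and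
`q` there is at most one such `r`; if there is none, then `q` is not in the domain of the partial
string function computed by `c`. -/
def Outputs (c : Nat.Partrec.Code) (q r : Cantor) : Prop :=
  ∀ k, (r k).toNat ∈ machineSymbol c q k

/-- The infinite string `0ⁿ 1 p`. -/
def tagged (n : ℕ) (p : Cantor) : Cantor := fun k =>
  if k < n then false else if k = n then true else p (k - n - 1)

/-- The standard representation `η^{ωω}` of the continuous partial string functions with
`G_δ` domain: the string `0ⁿ 1 p` is a name of the function that maps `q` to the output of the
machine number `n` on `⟨p, q⟩`. `EtaApply s q r` says that the function named by `s` maps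
`q` to `r`. -/
def EtaApply (s q r : Cantor) : Prop :=
  ∃ (n : ℕ) (p : Cantor), s = tagged n p ∧
    Outputs (Denumerable.ofNat Nat.Partrec.Code n) (pairStr p q) r

/-! ### Representations -/

/-- A representation of (a subset of) `A`, as the relation "`p` is a name of `a`". -/
abbrev Rep (A : Type*) : Type _ := Cantor → A → Prop

/-- `a` is `δ`-computable: it has a computable name. -/
def IsComputablePoint {A : Type*} (δ : Rep A) (a : A) : Prop :=
  ∃ p : Cantor, Computable p ∧ δ p a

/-- The product representation. -/
def Rep.prod {A B : Type*} (δ : Rep A) (γ : Rep B) : Rep (A × B) := fun r ab =>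
  ∃ p q, r = pairStr p q ∧ δ p ab.1 ∧ γ q ab.2

/-- `f` is `(δ → γ)`-computable: some machine converts every `δ`-name of every `a` to a
`γ`-name of `f a`. -/
def IsComputableFun {A B : Type*} (δ : Rep A) (γ : Rep B) (f : A → B) : Prop :=
  ∃ c : Nat.Partrec.Code, ∀ p a, δ p a → ∃ r, Outputs c p r ∧ γ r (f a)

/-- `f` is `(δ → γ)`-continuous: it has a continuous realization. -/
def IsContinuousFun {A B : Type*} (δ : Rep A) (γ : Rep B) (f : A → B) : Prop :=
  ∃ F : Cantor → Cantor, ContinuousOn F {p | ∃ a, δ p a} ∧ ∀ p a, δ p a → γ (F p) (f a)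

/-- `s` is an `η^{ωω}`-name of a `(δ → γ)`-realization of `f`. -/
def realizerRep {A B : Type*} (δ : Rep A) (γ : Rep B) : Rep (A → B) := fun s f =>
  ∀ p a, δ p a → ∃ r, EtaApply s p r ∧ γ r (f a)

/-! ### Sequences of rational numbers, vectors and balls -/

/-- The infinite string `p` encodes the sequence `a` of natural numbers: it is the characteristic
sequence of the graph of `a`. -/
def Codes (p : Cantor) (a : ℕ → ℕ) : Prop := ∀ n k, p (Nat.pair n k) = true ↔ k = a n

/-- The numbering `⟨⟨a, b⟩, c⟩ ↦ (a - b) / (c + 1)` of the rational numbers. -/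
def ratOf (n : ℕ) : ℚ :=
  ((n.unpair.1.unpair.1 : ℚ) - (n.unpair.1.unpair.2 : ℚ)) / ((n.unpair.2 : ℚ) + 1)

/-- A numbering of `ℚ^D`: `n = ⟨n₀, ⟨n₁, ⟨n₂, …⟩⟩⟩` stands for the vector with the coordinates
`ratOf n₀`, `ratOf n₁`, …. -/
def ratVecOf (D : ℕ) (n : ℕ) (i : Fin D) : ℚ :=
  ratOf ((fun j : ℕ => j.unpair.2)^[i] n).unpair.1

/-- A numbering of the open rational balls of `ℝ^D`; a radius `≤ 0` gives the empty set. -/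
def ratBall (D : ℕ) (n : ℕ) : Set (EuclideanSpace ℝ (Fin D)) :=
  Metric.ball (WithLp.toLp 2 fun i => (ratVecOf D n.unpair.1 i : ℝ)) (ratOf n.unpair.2 : ℝ)

/-! ### Representations of points -/

/-- The representation `ρ` of the points of `X ⊆ ℝ^D`: rational vectors `q_m` with
`|x_i - q_{m,i}| ≤ 2^{-m}` for every coordinate `i`. -/
def rho {D : ℕ} (X : Set (EuclideanSpace ℝ (Fin D))) : Rep X := fun p x =>
  ∃ a, Codes p a ∧ ∀ m i, |x.1 i - (ratVecOf D (a m) i : ℝ)| ≤ (2 : ℝ)⁻¹ ^ m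

/-- `sup_{n₀} inf_{n₁} sup_{n₂} … p_⟨n₀, …, n_d⟩` (if the flag is `true`) and
`inf_{n₀} sup_{n₁} inf_{n₂} … p_⟨n₀, …, n_d⟩` (if it is `false`), in the extended reals. -/
def altLimit : ℕ → Bool → (ℕ → ℚ) → EReal
  | 0, true, p => ⨆ n, ((p n : ℝ) : EReal)
  | 0, false, p => ⨅ n, ((p n : ℝ) : EReal)
  | d + 1, true, p => ⨆ m, altLimit d false fun n => p (Nat.pair m n)
  | d + 1, false, p => ⨅ m, altLimit d true fun n => p (Nat.pair m n)

/-- The representation `ρ_<^{(d)}` of `ℝ`. -/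
def rhoLower (d : ℕ) : Rep ℝ := fun p y =>
  ∃ a, Codes p a ∧ altLimit d true (fun n => ratOf (a n)) = (y : EReal)

/-- The representation `ρ_>` of `ℝ`: rational sequences with infimum `y`. -/
def rhoUpper : Rep ℝ := fun p y =>
  ∃ a, Codes p a ∧ altLimit 0 false (fun n => ratOf (a n)) = (y : EReal)

/-! ### Borel sets -/

/-- The representation `θ_<` of the open subsets of `ℝ^D`. -/
def thetaLower (D : ℕ) : Rep (Set (EuclideanSpace ℝ (Fin D))) := fun p U =>
  ∃ a, Codes p a ∧ U = ⋃ m, ratBall D (a m)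

/-- Recursively open subsets of `ℝ^D`. -/
def RecursivelyOpen {D : ℕ} (X : Set (EuclideanSpace ℝ (Fin D))) : Prop :=
  IsComputablePoint (thetaLower D) X

/-- The finite levels `Σ_d`, `d ≥ 1`, of the Borel hierarchy of a topological space (there is no
level `0`). -/
def BorelSigma {Y : Type*} [TopologicalSpace Y] : ℕ → Set Y → Prop
  | 0, _ => False
  | 1, S => IsOpen S
  | d + 2, S => ∃ T : ℕ → Set Y, (∀ m, BorelSigma (d + 1) (T m)) ∧ S = ⋃ m, (T m)ᶜ

/-- The representation `δ_{Σ_d}` of `Σ_d(X)`, `d ≥ 1`. The complements are taken in `X`. -/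
def sigmaRep {D : ℕ} (X : Set (EuclideanSpace ℝ (Fin D))) : ℕ → Rep (Set X)
  | 0 => fun _ _ => False
  | 1 => fun p S => thetaLower D p (Subtype.val '' S)
  | d + 2 => fun p S =>
      ∃ T : ℕ → Set X, (∀ m, sigmaRep X (d + 1) (component p m) (T m)) ∧ S = ⋃ m, (T m)ᶜ

/-! ### Lower semimeasurable functions -/

/-- `Σ_d`-lowersemimeasurable functions. -/
def LowerSemimeasurable {Y : Type*} [TopologicalSpace Y] (d : ℕ) (f : Y → ℝ) : Prop :=
  ∀ y : ℝ, BorelSigma d (f ⁻¹' Set.Ioi y)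

/-- Effectively `Σ_d`-lowersemimeasurable functions. -/
def EffectivelyLowerSemimeasurable {D : ℕ} {X : Set (EuclideanSpace ℝ (Fin D))} (d : ℕ)
    (f : X → ℝ) : Prop :=
  LowerSemimeasurable d f ∧
    IsComputableFun rhoUpper (sigmaRep X d) fun y : ℝ => f ⁻¹' Set.Ioi y

/-- The representation `[ρ → ρ_<^{(d)}]` of the `Σ_{d+1}`-lowersemimeasurable functions on `X`:
the join of `δ_{Σ_{d+1}}`-names of the sets `f⁻¹(y, ∞)` for all rational `y`. -/
def semiRep {D : ℕ} (X : Set (EuclideanSpace ℝ (Fin D))) (d : ℕ) :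
    Rep {f : X → ℝ // LowerSemimeasurable (d + 1) f} := fun p f =>
  ∀ n, sigmaRep X (d + 1) (component p n) (f.1 ⁻¹' Set.Ioi (ratOf n : ℝ))

end HyperSemi

end

namespace HyperSemi

/-! ### Total computable functionals on Cantor space -/

/-! Parts (a) and (b) rest on the shape of membership. Given names of S and x, "x ∈ S" is an
alternating formula ∃ m₁ ¬ ∃ m₂ ¬ … whose leaves are decided by finite parts of the names
(`mem_iff_altSat`). Two rational values placed at the leaves turn the quantifiers into suprema and
infima (`altLimit_leaf`); the values 1 and 0 give the characteristic function. For the apply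
operator, f(x) is the supremum of the rationals below it. In the lowest class these are enumerated.
In higher classes every rational r is offered for every candidate witness m of r < f(x), with the
penalties r - j, whose infimum over j is -∞ if m fails; the additional operators are absorbed by
neighbours of the same kind (`altLimit_merge`).

For (c), a realization makes f(x) > u an alternating formula about any given name of x
(`altSat_margin`), but a quantifier over names would leave the Borel class. Forcing removes it.
`Reach` replaces truth along a name by "forced by some finite list compatible with x", with negation
read as "forced by no compatible extension". A generic name (`exists_generic`) decides all of these
countably many conditions, so along it truth is forcing; since f(x) does not depend on the name, one
generic name is enough (`reach_iff`). Compatibility with a list is an open condition on x and all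
quantifiers in `Reach` are countable, so the points reached form a set of the right class, and a
name of it is computed from the table of leaves (`sigmaRep_reachName`). A realization enters only
through `Simulates`: by an ineffective table for continuous functions (`exists_simulates`), by
running the named machine for the effective statements (`simulates_nameSim`). -/

/-- The prefix of length `n` of a sequence. -/
def pre {α : Type*} (a : ℕ → α) (n : ℕ) : List α := (List.range n).map a

/-- `F` is a total computable functional: its values are computed from sufficiently long prefixes
of the first argument. -/
def TC {α β : Type*} [Primcodable α] [Primcodable β] (F : Cantor → α → β) : Prop :=
  ∃ g : List Bool → α → Option β, Computable₂ g ∧ ∀ q a,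
    (∀ n b, g (pre q n) a = some b → b = F q a) ∧
      ∃ N, ∀ n, N ≤ n → g (pre q n) a = some (F q a)

section TC

variable {α β γ σ : Type*} [Primcodable α] [Primcodable β] [Primcodable γ] [Primcodable σ]

theorem TC.of_computable {f : α → β} (hf : Computable f) : TC fun _ a => f a :=
  ⟨fun _ a => some (f a), (Computable.option_some.comp (hf.comp Computable.snd)).to₂,
    fun _ _ => ⟨fun _ _ h => (Option.some.inj h).symm, 0, fun _ _ => rfl⟩⟩

theorem TC.of_primrec {f : α → β} (hf : Primrec f) : TC fun _ a => f a :=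
  .of_computable hf.to_comp

theorem TC.const (b : β) : TC fun _ (_ : α) => b := .of_computable (Computable.const b)

theorem TC.id : TC fun _ (a : α) => a := .of_computable Computable.id

theorem TC.query : TC fun q (n : ℕ) => q n := by
  refine ⟨fun w n => w[n]?, Computable.list_getElem?, fun q a => ⟨fun n b h => ?_, a + 1, ?_⟩⟩
  · simp only [pre, List.getElem?_map, Option.map_eq_some_iff, List.getElem?_eq_some_iff] at h
    obtain ⟨x, ⟨h1, h2⟩, h3⟩ := h
    simp at h2
    rw [← h3, h2]
  · intro n hn
    simp [pre, List.getElem?_range (show a < n by omega)]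

theorem TC.comp {G : Cantor → β → γ} {F : Cantor → α → β} (hG : TC G) (hF : TC F) :
    TC fun q a => G q (F q a) := by
  obtain ⟨g, hg, hg'⟩ := hG
  obtain ⟨f, hf, hf'⟩ := hF
  refine ⟨fun w a => (f w a).bind (g w), ?_, fun q a => ⟨fun n b h => ?_, ?_⟩⟩
  · exact (Computable.option_bind hf
      (hg.comp (Computable.fst.comp Computable.fst) Computable.snd).to₂).to₂
  · obtain ⟨x, hx, hx'⟩ := Option.bind_eq_some_iff.1 h
    rw [(hf' q a).1 n x hx] at hx'
    exact (hg' q _).1 n b hx'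
  · obtain ⟨N, hN⟩ := (hf' q a).2
    obtain ⟨M, hM⟩ := (hg' q (F q a)).2
    exact ⟨max N M, fun n hn => by simp [hN n (by omega), hM n (by omega)]⟩

theorem TC.pair {F : Cantor → α → β} {G : Cantor → α → γ} (hF : TC F) (hG : TC G) :
    TC fun q a => (F q a, G q a) := by
  obtain ⟨g, hg, hg'⟩ := hG
  obtain ⟨f, hf, hf'⟩ := hF
  refine ⟨fun w a => (f w a).bind fun x => (g w a).map fun y => (x, y), ?_,
    fun q a => ⟨fun n b h => ?_, ?_⟩⟩
  · refine (Computable.option_bind hf (Computable.option_map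
      (hg.comp (Computable.fst.comp Computable.fst) (Computable.snd.comp Computable.fst))
      (Computable.pair (Computable.snd.comp Computable.fst) Computable.snd).to₂).to₂).to₂
  · obtain ⟨x, hx, hx'⟩ := Option.bind_eq_some_iff.1 h
    obtain ⟨y, hy, hy'⟩ := Option.map_eq_some_iff.1 hx'
    rw [← hy', (hf' q a).1 n x hx, (hg' q a).1 n y hy]
  · obtain ⟨N, hN⟩ := (hf' q a).2
    obtain ⟨M, hM⟩ := (hg' q a).2
    exact ⟨max N M, fun n hn => by simp [hN n (by omega), hM n (by omega)]⟩

theorem TC.app {f : β → γ} (hf : Computable f) {F : Cantor → α → β} (hF : TC F) :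
    TC fun q a => f (F q a) := (TC.of_computable hf).comp hF

theorem TC.app₂ {f : β → γ → σ} (hf : Computable₂ f) {F : Cantor → α → β} {G : Cantor → α → γ}
    (hF : TC F) (hG : TC G) : TC fun q a => f (F q a) (G q a) :=
  TC.app (f := fun x : β × γ => f x.1 x.2) hf (hF.pair hG)

theorem TC.fst {F : Cantor → α → β × γ} (hF : TC F) : TC fun q a => (F q a).1 :=
  hF.app Computable.fst

theorem TC.snd {F : Cantor → α → β × γ} (hF : TC F) : TC fun q a => (F q a).2 :=
  hF.app Computable.snd

theorem TC.left {F : Cantor → α → ℕ} (hF : TC F) : TC fun q a => (F q a).unpair.1 :=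
  (hF.app Computable.unpair).fst

theorem TC.right {F : Cantor → α → ℕ} (hF : TC F) : TC fun q a => (F q a).unpair.2 :=
  (hF.app Computable.unpair).snd

theorem TC.natPair {F G : Cantor → α → ℕ} (hF : TC F) (hG : TC G) :
    TC fun q a => Nat.pair (F q a) (G q a) := hF.app₂ Primrec₂.natPair.to_comp hG

theorem TC.and {F G : Cantor → α → Bool} (hF : TC F) (hG : TC G) :
    TC fun q a => F q a && G q a := hF.app₂ Primrec.and.to_comp hG

theorem TC.or {F G : Cantor → α → Bool} (hF : TC F) (hG : TC G) :
    TC fun q a => F q a || G q a := hF.app₂ Primrec.or.to_comp hG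

theorem TC.not {F : Cantor → α → Bool} (hF : TC F) : TC fun q a => !F q a :=
  hF.app Primrec.not.to_comp

theorem TC.decideEq [DecidableEq β] {F G : Cantor → α → β} (hF : TC F) (hG : TC G) :
    TC fun q a => decide (F q a = G q a) :=
  (hF.app₂ (f := fun x y => decide (x = y)) (PrimrecRel.decide Primrec.eq).to_comp hG)

theorem TC.ite {C : Cantor → α → Bool} {F G : Cantor → α → β} (hC : TC C) (hF : TC F)
    (hG : TC G) : TC fun q a => if C q a = true then F q a else G q a := by
  have h : Computable fun x : Bool × β × β => cond x.1 x.2.1 x.2.2 :=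
    Computable.cond Computable.fst (Computable.fst.comp Computable.snd)
      (Computable.snd.comp Computable.snd)
  have := TC.app h (hC.pair (hF.pair hG))
  simpa only [Bool.cond_eq_ite] using this

theorem TC.nat_rec {F : Cantor → α → ℕ} {G : Cantor → α → σ} {H : Cantor → α × ℕ × σ → σ}
    (hF : TC F) (hG : TC G) (hH : TC H) :
    TC fun q a => Nat.rec (motive := fun _ => σ) (G q a) (fun n ih => H q (a, n, ih)) (F q a) := by
  -- The length of the recursion becomes an argument of its own, so that induction on it is
  -- possible; `F` is substituted at the end.
  have key : TC fun q (x : α × ℕ) =>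
      Nat.rec (motive := fun _ => σ) (G q x.1) (fun n ih => H q (x.1, n, ih)) x.2 := by
    obtain ⟨g, hg, hg'⟩ := hG
    obtain ⟨h, hh, hh'⟩ := hH
    refine ⟨fun w x => Nat.rec (motive := fun _ => Option σ) (g w x.1)
      (fun n ih => ih.bind fun y => h w (x.1, n, y)) x.2, ?_, ?_⟩
    · refine (Computable.nat_rec (f := fun z : List Bool × α × ℕ => z.2.2)
        (g := fun z : List Bool × α × ℕ => g z.1 z.2.1)
        (h := fun (z : List Bool × α × ℕ) (y : ℕ × Option σ) =>
          y.2.bind fun s => h z.1 (z.2.1, y.1, s))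
        (Computable.snd.comp Computable.snd)
        (hg.comp Computable.fst (Computable.fst.comp Computable.snd)) ?_).to₂
      refine (Computable.option_bind
        (f := fun y : (List Bool × α × ℕ) × ℕ × Option σ => y.2.2)
        (g := fun y s => h y.1.1 (y.1.2.1, y.2.1, s))
        (Computable.snd.comp Computable.snd) ?_).to₂
      refine (hh.comp (Computable.fst.comp (Computable.fst.comp Computable.fst))
        (Computable.pair (Computable.fst.comp (Computable.snd.comp
          (Computable.fst.comp Computable.fst)))
          (Computable.pair (Computable.fst.comp (Computable.snd.comp Computable.fst))
            Computable.snd))).to₂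
    · rintro q ⟨a, k⟩
      induction k with
      | zero => exact hg' q a
      | succ k ih =>
        simp only at ih ⊢
        refine ⟨fun n b hb => ?_, ?_⟩
        · obtain ⟨x, hx, hx'⟩ := Option.bind_eq_some_iff.1 hb
          rw [ih.1 n x hx] at hx'
          exact (hh' q _).1 n b hx'
        · obtain ⟨N, hN⟩ := ih.2
          obtain ⟨M, hM⟩ := (hh' q (a, k, Nat.rec (motive := fun _ => σ) (G q a)
            (fun n ih => H q (a, n, ih)) k)).2
          refine ⟨max N M, fun n hn => ?_⟩
          rw [hN n (by omega)]
          exact hM n (by omega)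
  exact key.comp (TC.id.pair hF)

theorem TC.map_range {N : Cantor → α → ℕ} {F : Cantor → α × ℕ → β} (hN : TC N) (hF : TC F) :
    TC fun q a => pre (fun n => F q (a, n)) (N q a) := by
  have h : TC fun q (x : α × ℕ × List β) => x.2.2 ++ [F q (x.1, x.2.1)] :=
    TC.app₂ Computable.list_concat TC.id.snd.snd (hF.comp (TC.id.fst.pair TC.id.snd.fst))
  have h' := TC.nat_rec hN (TC.const ([] : List β)) h
  convert h' using 3 with q a
  induction N q a with
  | zero => rfl
  | succ n ih => simp only [pre, List.range_succ, List.map_append] at ih ⊢; rw [ih]; rfl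

theorem TC.all {N : Cantor → α → ℕ} {F : Cantor → α × ℕ → Bool} (hN : TC N) (hF : TC F) :
    TC fun q a => (List.range (N q a)).all fun n => F q (a, n) := by
  have h : TC fun q (x : α × ℕ × Bool) => x.2.2 && F q (x.1, x.2.1) :=
    TC.and TC.id.snd.snd (hF.comp (TC.id.fst.pair TC.id.snd.fst))
  have h' := TC.nat_rec hN (TC.const true) h
  convert h' using 3 with q a
  induction N q a with
  | zero => rfl
  | succ n ih => rw [List.range_succ, List.all_append, ih]; simp

theorem TC.any {N : Cantor → α → ℕ} {F : Cantor → α × ℕ → Bool} (hN : TC N) (hF : TC F) :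
    TC fun q a => (List.range (N q a)).any fun n => F q (a, n) := by
  have h := (TC.all hN hF.not).not
  simpa only [List.not_all_eq_any_not, Bool.not_not] using h

/-- The first value of `f` among the arguments `0, …, n - 1`. -/
def firstBelow {α : Type*} (f : ℕ → Option α) (n : ℕ) : Option α :=
  Nat.rec (motive := fun _ => Option α) none (fun k ih => ih <|> f k) n

theorem TC.firstBelow {N : Cantor → α → ℕ} {F : Cantor → α × ℕ → Option β} (hN : TC N)
    (hF : TC F) : TC fun q a => HyperSemi.firstBelow (fun n => F q (a, n)) (N q a) :=
  TC.nat_rec hN (TC.const none) (H := fun q x => x.2.2 <|> F q (x.1, x.2.1))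
    (TC.app₂ Primrec.option_orElse.to_comp TC.id.snd.snd
      (hF.comp (TC.id.fst.pair TC.id.snd.fst)))

end TC

theorem firstBelow_eq_none {α : Type*} {f : ℕ → Option α} {n : ℕ} :
    firstBelow f n = none ↔ ∀ k < n, f k = none := by
  induction n with
  | zero => simp [firstBelow]
  | succ n ih =>
    have : firstBelow f (n + 1) = (firstBelow f n <|> f n) := rfl
    rw [this]
    constructor
    · intro h
      cases h' : firstBelow f n with
      | some x => simp [h'] at h
      | none =>
        intro k hk
        rcases Nat.lt_succ_iff_lt_or_eq.1 hk with hk | rfl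
        · exact ih.1 h' k hk
        · simpa [h'] using h
    · intro h
      rw [ih.2 fun k hk => h k (by omega), h n (by omega)]; rfl

theorem firstBelow_eq_some {α : Type*} {f : ℕ → Option α} {n : ℕ} {x : α} :
    firstBelow f n = some x ↔ ∃ m < n, f m = some x ∧ ∀ k < m, f k = none := by
  induction n with
  | zero => simp [firstBelow]
  | succ n ih =>
    have : firstBelow f (n + 1) = (firstBelow f n <|> f n) := rfl
    rw [this]
    constructor
    · intro h
      cases h' : firstBelow f n with
      | some y =>
        simp only [h', Option.orElse_eq_orElse, Option.orElse_some, Option.some.injEq] at h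
        obtain ⟨m, hm, h2⟩ := ih.1 (h ▸ h')
        exact ⟨m, by omega, h2⟩
      | none => exact ⟨n, by omega, by simpa [h'] using h, firstBelow_eq_none.1 h'⟩
    · rintro ⟨m, hm, h1, h2⟩
      rcases Nat.lt_succ_iff_lt_or_eq.1 hm with hm | rfl
      · rw [ih.2 ⟨m, hm, h1, h2⟩]; rfl
      · rw [firstBelow_eq_none.2 h2, h1]; rfl

/-! ### From functionals and unbounded searches to Type-2 machines. -/

/-- Dovetailing keeps whichever answer comes first, so all prefixes on which the program halts must
agree; then one halting prefix suffices. -/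
theorem machineSymbol_spec {c : Nat.Partrec.Code} {q : Cantor} {k v : ℕ}
    (hs : ∀ n x, x ∈ c.eval (Nat.pair (Encodable.encode (pre q n)) k) → x = v)
    (hd : ∃ n, v ∈ c.eval (Nat.pair (Encodable.encode (pre q n)) k)) :
    v ∈ machineSymbol c q k := by
  obtain ⟨n, hn⟩ := hd
  obtain ⟨s, hs'⟩ := Nat.Partrec.Code.evaln_complete.1 hn
  have hdom : (machineSymbol c q k).Dom := by
    refine Nat.rfindOpt_dom.2 ⟨Nat.pair n s, v, ?_⟩
    simpa only [Nat.unpair_pair, pre] using hs'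
  have hmem := Part.get_mem hdom
  obtain ⟨t, ht⟩ := Nat.rfindOpt_spec hmem
  rwa [hs _ _ (Nat.Partrec.Code.evaln_sound ht)] at hmem

theorem exists_machine_of_search {P : Cantor → ℕ × ℕ → Option Bool} (hP : TC P) :
    ∃ c : Nat.Partrec.Code, ∀ q r,
      (∀ k, ∃ n, P q (k, n) = some (r k) ∧ ∀ m < n, P q (k, m) = none) → Outputs c q r := by
  obtain ⟨g, hg, hg'⟩ := hP
  let w : ℕ → List Bool := fun z => (Encodable.decode z.unpair.1).getD []
  have hw : Computable w := Computable.option_getD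
    (Computable.decode.comp (Computable.fst.comp Computable.unpair)) (Computable.const [])
  have hsnd : Computable fun z : ℕ => z.unpair.2 := Computable.snd.comp Computable.unpair
  have hgz : Computable₂ fun z n : ℕ => g (w z) (z.unpair.2, n) :=
    (hg.comp (hw.comp Computable.fst) (Computable.pair (hsnd.comp Computable.fst)
      Computable.snd)).to₂
  -- The search halts at the first stage not known to fail, and diverges if that stage is still
  -- undecided on the prefix. Skipping it could return a later, wrong answer.
  let h : ℕ →. ℕ := fun z =>
    (Nat.rfind fun n => Part.some (decide (g (w z) (z.unpair.2, n) ≠ some none))).bind fun n =>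
      (((g (w z) (z.unpair.2, n)).bind fun x => x.map Bool.toNat : Option ℕ) : Part ℕ)
  have hh : Nat.Partrec h := by
    rw [← Partrec.nat_iff]
    refine Partrec.bind (Partrec.rfind ?_) ?_
    · exact (Computable.partrec ((Primrec.dom_finite
        (fun x : Option (Option Bool) => decide (x ≠ some none))).to_comp.comp hgz)).to₂
    · exact (Computable.ofOption ((Primrec.dom_finite (fun x : Option (Option Bool) =>
        x.bind fun y => y.map Bool.toNat)).to_comp.comp hgz)).to₂
  obtain ⟨c, hc⟩ := Nat.Partrec.Code.exists_code.1 hh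
  refine ⟨c, fun q r hr k => ?_⟩
  obtain ⟨m, hm, hm'⟩ := hr k
  have hwz : ∀ n, w (Nat.pair (Encodable.encode (pre q n)) k) = pre q n := fun n => by
    simp [w, Encodable.encodek]
  apply machineSymbol_spec
  · intro n x hx
    rw [hc] at hx
    obtain ⟨i, hi, hi'⟩ := Part.mem_bind_iff.1 hx
    obtain ⟨h1, h2⟩ := Nat.mem_rfind.1 hi
    simp only [hwz, Nat.unpair_pair, Part.mem_some_iff] at h1 h2 hi'
    have hlow : ∀ j < i, P q (k, j) = none := fun j hj => by
      have := h2 hj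
      simp at this
      exact ((hg' q (k, j)).1 n _ this).symm
    simp only [Part.mem_coe, Option.mem_def, Option.bind_eq_some_iff,
      Option.map_eq_some_iff] at hi'
    obtain ⟨y, hy, b, rfl, rfl⟩ := hi'
    have hPi := (hg' q (k, i)).1 n _ hy
    have : i = m := by
      rcases lt_trichotomy i m with hlt | heq | hlt
      · rw [hm' i hlt] at hPi; cases hPi
      · exact heq
      · rw [hlow m hlt] at hm; cases hm
    subst this
    rw [hm] at hPi
    rw [Option.some.inj hPi]
  -- A single prefix has to settle all stages up to the successful one.
  · have hN : ∃ N, ∀ n ≥ N, ∀ j ≤ m, g (pre q n) (k, j) = some (P q (k, j)) := by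
      clear hm hm'
      induction m with
      | zero =>
        obtain ⟨N, hN⟩ := (hg' q (k, 0)).2
        exact ⟨N, fun n hn j hj => by rw [Nat.le_zero.1 hj]; exact hN n hn⟩
      | succ m ih =>
        obtain ⟨N, hN⟩ := ih
        obtain ⟨M, hM⟩ := (hg' q (k, m + 1)).2
        refine ⟨max N M, fun n hn j hj => ?_⟩
        rcases Nat.le_succ_iff.1 hj with hj | rfl
        · exact hN n (by omega) j hj
        · exact hM n (by omega)
    obtain ⟨N, hN⟩ := hN
    refine ⟨N, ?_⟩
    rw [hc]
    refine Part.mem_bind_iff.2 ⟨m, Nat.mem_rfind.2 ⟨?_, fun {j} hj => ?_⟩, ?_⟩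
    · simp [hwz, hN N le_rfl m le_rfl, hm]
    · simp [hwz, hN N le_rfl j hj.le, hm' j hj]
    · simp [hwz, hN N le_rfl m le_rfl, hm]

theorem exists_machine {F : Cantor → ℕ → Bool} (hF : TC F) :
    ∃ c : Nat.Partrec.Code, ∀ q, Outputs c q (F q) := by
  obtain ⟨c, hc⟩ := exists_machine_of_search (P := fun q x => some (F q x.1))
    (TC.app Computable.option_some (hF.comp TC.id.fst))
  exact ⟨c, fun q => hc q _ fun k => ⟨0, rfl, by simp⟩⟩

/-- The step `t` of the dovetailed computation of the output symbol number `k`. -/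
def machineStep (c : Nat.Partrec.Code) (q : Cantor) (k t : ℕ) : Option ℕ :=
  c.evaln t.unpair.2 (Nat.pair (Encodable.encode (pre q t.unpair.1)) k)

theorem mem_machineSymbol {c : Nat.Partrec.Code} {q : Cantor} {k v : ℕ} :
    v ∈ machineSymbol c q k ↔
      ∃ t, machineStep c q k t = some v ∧ ∀ s < t, machineStep c q k s = none := by
  change v ∈ Nat.rfindOpt (machineStep c q k) ↔ _
  rw [Nat.rfindOpt, Part.mem_bind_iff]
  refine exists_congr fun t => ?_
  refine (and_congr_left' Nat.mem_rfind).trans ?_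
  simp only [Part.mem_coe, Option.mem_def, Option.some.injEq]
  constructor
  · rintro ⟨⟨_, h⟩, h'⟩
    refine ⟨h', fun s hs => ?_⟩
    exact Option.not_isSome_iff_eq_none.1 (by simp [h hs])
  · rintro ⟨h', h⟩
    exact ⟨⟨by simp [h'], fun {s} hs => by simp [h s hs]⟩, h'⟩

theorem TC.machineStep {α : Type*} [Primcodable α] {C : Cantor → α → Nat.Partrec.Code}
    {F : Cantor → α × ℕ → Bool} {K T : Cantor → α → ℕ} (hC : TC C) (hF : TC F) (hK : TC K)
    (hT : TC T) : TC fun q a =>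
      HyperSemi.machineStep (C q a) (fun n => F q (a, n)) (K q a) (T q a) := by
  have h := TC.of_primrec Nat.Partrec.Code.primrec_evaln
  exact h.comp ((hT.right.pair hC).pair
    (((TC.map_range hT.left hF).app Computable.encode).natPair hK))

/-- Machines can be composed with total computable functionals. -/
theorem exists_machine_comp {F : Cantor → ℕ → Bool} (hF : TC F) (c : Nat.Partrec.Code) :
    ∃ c' : Nat.Partrec.Code, ∀ q r, Outputs c (F q) r → Outputs c' q r := by
  -- The dovetailing phase of `c` serves as the search index, and comparing with 1 turns its
  -- numerical answer into a symbol.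
  have h : TC fun q (x : ℕ × ℕ) => (machineStep c (F q) x.1 x.2).map fun v => decide (v = 1) := by
    refine TC.app (f := fun o : Option ℕ => o.map fun v => decide (v = 1)) ?_
      (TC.machineStep (F := fun q x => F q x.2) (TC.const c) (hF.comp TC.id.snd) TC.id.fst
        TC.id.snd)
    exact Computable.option_map Computable.id
      ((PrimrecRel.decide Primrec.eq).to_comp.comp Computable.snd (Computable.const 1)).to₂
  obtain ⟨c', hc'⟩ := exists_machine_of_search h
  refine ⟨c', fun q r hr => hc' q r fun k => ?_⟩
  obtain ⟨t, ht, ht'⟩ := mem_machineSymbol.1 (hr k)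
  refine ⟨t, ?_, fun m hm => by simp [ht' m hm]⟩
  rw [ht]
  cases r k <;> rfl

/-! ### Arithmetic on codes of rational numbers -/

section Prim

variable {α : Type*} [Primcodable α] {f g : α → ℕ}

theorem prim_left (hf : Primrec f) : Primrec fun a => (f a).unpair.1 :=
  Primrec.fst.comp (Primrec.unpair.comp hf)

theorem prim_right (hf : Primrec f) : Primrec fun a => (f a).unpair.2 :=
  Primrec.snd.comp (Primrec.unpair.comp hf)

theorem prim_add (hf : Primrec f) (hg : Primrec g) : Primrec fun a => f a + g a :=
  Primrec.nat_add.comp hf hg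

theorem prim_mul (hf : Primrec f) (hg : Primrec g) : Primrec fun a => f a * g a :=
  Primrec.nat_mul.comp hf hg

theorem prim_succ (hf : Primrec f) : Primrec fun a => f a + 1 := Primrec.succ.comp hf

theorem prim_pair (hf : Primrec f) (hg : Primrec g) : Primrec fun a => Nat.pair (f a) (g a) :=
  Primrec₂.natPair.comp hf hg

end Prim

/-- The code of `(a - b) / (c + 1)`. -/
def ratMk (a b c : ℕ) : ℕ := Nat.pair (Nat.pair a b) c

theorem ratOf_ratMk (a b c : ℕ) : ratOf (ratMk a b c) = ((a : ℚ) - b) / (c + 1) := by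
  simp [ratOf, ratMk]

/-- Addition on codes. -/
def addc (m n : ℕ) : ℕ :=
  ratMk (m.unpair.1.unpair.1 * (n.unpair.2 + 1) + n.unpair.1.unpair.1 * (m.unpair.2 + 1))
    (m.unpair.1.unpair.2 * (n.unpair.2 + 1) + n.unpair.1.unpair.2 * (m.unpair.2 + 1))
    (m.unpair.2 * n.unpair.2 + m.unpair.2 + n.unpair.2)

/-- Multiplication on codes. -/
def mulc (m n : ℕ) : ℕ :=
  ratMk (m.unpair.1.unpair.1 * n.unpair.1.unpair.1 + m.unpair.1.unpair.2 * n.unpair.1.unpair.2)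
    (m.unpair.1.unpair.1 * n.unpair.1.unpair.2 + m.unpair.1.unpair.2 * n.unpair.1.unpair.1)
    (m.unpair.2 * n.unpair.2 + m.unpair.2 + n.unpair.2)

/-- Subtraction on codes. -/
def subc (m n : ℕ) : ℕ := addc m (ratMk n.unpair.1.unpair.2 n.unpair.1.unpair.1 n.unpair.2)

/-- The order on codes. -/
def ltc (m n : ℕ) : Bool :=
  decide (m.unpair.1.unpair.1 * (n.unpair.2 + 1) + n.unpair.1.unpair.2 * (m.unpair.2 + 1) <
    n.unpair.1.unpair.1 * (m.unpair.2 + 1) + m.unpair.1.unpair.2 * (n.unpair.2 + 1))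

theorem ratOf_addc (m n : ℕ) : ratOf (addc m n) = ratOf m + ratOf n := by
  rw [addc, ratOf_ratMk, ratOf, ratOf]
  push_cast
  have h1 : (m.unpair.2 : ℚ) + 1 ≠ 0 := by positivity
  have h2 : (n.unpair.2 : ℚ) + 1 ≠ 0 := by positivity
  have h3 : (m.unpair.2 : ℚ) * n.unpair.2 + m.unpair.2 + n.unpair.2 + 1 ≠ 0 := by positivity
  rw [div_add_div _ _ h1 h2, div_eq_div_iff h3 (mul_ne_zero h1 h2)]
  ring

theorem ratOf_mulc (m n : ℕ) : ratOf (mulc m n) = ratOf m * ratOf n := by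
  rw [mulc, ratOf_ratMk, ratOf, ratOf]
  push_cast
  rw [div_mul_div_comm]
  congr 1 <;> ring

theorem ratOf_subc (m n : ℕ) : ratOf (subc m n) = ratOf m - ratOf n := by
  rw [subc, ratOf_addc, ratOf_ratMk]
  simp only [ratOf]
  ring

theorem ltc_iff (m n : ℕ) : ltc m n = true ↔ ratOf m < ratOf n := by
  rw [ltc, decide_eq_true_iff, ratOf, ratOf, div_lt_div_iff₀ (by positivity) (by positivity),
    ← Nat.cast_lt (α := ℚ)]
  push_cast
  constructor <;> intro h <;> linarith

theorem ratOf_zero : ratOf 0 = 0 := by simp [ratOf]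

theorem ratOf_surjective : Function.Surjective ratOf := by
  intro q
  refine ⟨ratMk q.num.toNat (-q.num).toNat (q.den - 1), ?_⟩
  rw [ratOf_ratMk]
  have h1 : ((q.num.toNat : ℚ)) - ((-q.num).toNat : ℚ) = q.num := by
    have := Int.toNat_sub_toNat_neg q.num
    exact_mod_cast congrArg (Int.cast (R := ℚ)) this
  have h2 : ((q.den - 1 : ℕ) : ℚ) + 1 = q.den := by
    have := q.den_pos
    have h : q.den - 1 + 1 = q.den := by omega
    exact_mod_cast congrArg (Nat.cast (R := ℚ)) h
  rw [h1, h2, Rat.num_div_den]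

theorem primrec_addc : Primrec₂ addc := by
  have h1 := Primrec.fst (α := ℕ) (β := ℕ)
  have h2 := Primrec.snd (α := ℕ) (β := ℕ)
  exact prim_pair (prim_pair
    (prim_add (prim_mul (prim_left (prim_left h1)) (prim_succ (prim_right h2)))
      (prim_mul (prim_left (prim_left h2)) (prim_succ (prim_right h1))))
    (prim_add (prim_mul (prim_right (prim_left h1)) (prim_succ (prim_right h2)))
      (prim_mul (prim_right (prim_left h2)) (prim_succ (prim_right h1)))))
    (prim_add (prim_add (prim_mul (prim_right h1) (prim_right h2)) (prim_right h1))
      (prim_right h2))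

theorem primrec_mulc : Primrec₂ mulc := by
  have h1 := Primrec.fst (α := ℕ) (β := ℕ)
  have h2 := Primrec.snd (α := ℕ) (β := ℕ)
  exact prim_pair (prim_pair
    (prim_add (prim_mul (prim_left (prim_left h1)) (prim_left (prim_left h2)))
      (prim_mul (prim_right (prim_left h1)) (prim_right (prim_left h2))))
    (prim_add (prim_mul (prim_left (prim_left h1)) (prim_right (prim_left h2)))
      (prim_mul (prim_right (prim_left h1)) (prim_left (prim_left h2)))))
    (prim_add (prim_add (prim_mul (prim_right h1) (prim_right h2)) (prim_right h1))
      (prim_right h2))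

theorem primrec_subc : Primrec₂ subc := by
  have h2 := Primrec.snd (α := ℕ) (β := ℕ)
  exact primrec_addc.comp Primrec.fst (prim_pair (prim_pair (prim_right (prim_left h2))
    (prim_left (prim_left h2))) (prim_right h2))

theorem primrec_ltc : Primrec₂ ltc := by
  have h1 := Primrec.fst (α := ℕ) (β := ℕ)
  have h2 := Primrec.snd (α := ℕ) (β := ℕ)
  exact (PrimrecRel.decide Primrec.nat_lt).comp
    (prim_add (prim_mul (prim_left (prim_left h1)) (prim_succ (prim_right h2)))
      (prim_mul (prim_right (prim_left h2)) (prim_succ (prim_right h1))))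
    (prim_add (prim_mul (prim_left (prim_left h2)) (prim_succ (prim_right h1)))
      (prim_mul (prim_right (prim_left h1)) (prim_succ (prim_right h2))))

/-- A code of `k`. -/
def natc (k : ℕ) : ℕ := ratMk k 0 0

/-- A code of `1 / (k + 1)`. -/
def epsc (k : ℕ) : ℕ := ratMk 1 0 k

/-- A code of `2^{-m}`. -/
def powc (m : ℕ) : ℕ := ratMk 1 0 (Nat.rec (motive := fun _ => ℕ) 0 (fun _ c => 2 * c + 1) m)

theorem ratOf_natc (k : ℕ) : ratOf (natc k) = k := by simp [natc, ratOf_ratMk]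

theorem ratOf_epsc (k : ℕ) : ratOf (epsc k) = 1 / (k + 1) := by simp [epsc, ratOf_ratMk]

theorem ratOf_powc (m : ℕ) : ratOf (powc m) = 2⁻¹ ^ m := by
  -- Codes store the denominator minus one, and c ↦ 2c + 1 started at 0 yields 2^m - 1.
  have h : ∀ m : ℕ,
      ((Nat.rec (motive := fun _ => ℕ) 0 (fun _ c => 2 * c + 1) m : ℕ) : ℚ) + 1 = 2 ^ m := by
    intro m
    induction m with
    | zero => norm_num
    | succ m ih => rw [pow_succ, ← ih]; push_cast; ring
  rw [powc, ratOf_ratMk, h]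
  simp

theorem primrec_natc : Primrec natc :=
  prim_pair (prim_pair Primrec.id (Primrec.const 0)) (Primrec.const 0)

theorem primrec_epsc : Primrec epsc := prim_pair (Primrec.const _) Primrec.id

theorem primrec_powc : Primrec powc :=
  prim_pair (Primrec.const _) (Primrec.nat_rec₁ 0
    ((prim_succ (prim_mul (Primrec.const 2) Primrec.snd)).to₂ : Primrec₂ fun _ c => 2 * c + 1))

/-! ### Rational balls -/

/-- The rational point with code `n`. -/
def cen (D n : ℕ) : EuclideanSpace ℝ (Fin D) := WithLp.toLp 2 fun i => (ratVecOf D n i : ℝ)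

theorem ratVecOf_zero (D n : ℕ) : ratVecOf (D + 1) n 0 = ratOf n.unpair.1 := rfl

theorem ratVecOf_succ (D n : ℕ) (i : Fin D) :
    ratVecOf (D + 1) n i.succ = ratVecOf D n.unpair.2 i := by
  simp [ratVecOf, Function.iterate_succ_apply]

theorem ratVecOf_surjective (D : ℕ) : Function.Surjective (ratVecOf D) := by
  induction D with
  | zero => exact fun v => ⟨0, Subsingleton.elim _ _⟩
  | succ D ih =>
    intro v
    obtain ⟨n, hn⟩ := ih fun i => v i.succ
    obtain ⟨m, hm⟩ := ratOf_surjective (v 0)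
    refine ⟨Nat.pair m n, funext fun i => ?_⟩
    refine Fin.cases ?_ (fun j => ?_) i
    · simp [ratVecOf_zero, hm]
    · simp [ratVecOf_succ, hn]

theorem exists_cen_dist_lt {D : ℕ} (x : EuclideanSpace ℝ (Fin D)) {ε : ℝ} (hε : 0 < ε) :
    ∃ n, dist x (cen D n) < ε := by
  have h : DenseRange fun v : Fin D → ℚ =>
      (WithLp.toLp 2 fun i => (v i : ℝ) : EuclideanSpace ℝ (Fin D)) := by
    have h1 : DenseRange (Pi.map fun (_ : Fin D) (q : ℚ) => (q : ℝ)) :=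
      DenseRange.piMap fun _ => Rat.denseRange_cast
    exact (EuclideanSpace.equiv (Fin D) ℝ).symm.surjective.denseRange.comp h1
      (EuclideanSpace.equiv (Fin D) ℝ).symm.continuous
  obtain ⟨v, hv⟩ := h.exists_dist_lt x hε
  obtain ⟨n, rfl⟩ := ratVecOf_surjective D v
  exact ⟨n, hv⟩

/-- A code of the squared distance of two rational points. -/
def sqc : ℕ → ℕ → ℕ → ℕ
  | 0, _, _ => 0
  | D + 1, m, n => addc (mulc (subc m.unpair.1 n.unpair.1) (subc m.unpair.1 n.unpair.1))
      (sqc D m.unpair.2 n.unpair.2)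

theorem ratOf_sqc (D m n : ℕ) :
    ratOf (sqc D m n) = ∑ i, (ratVecOf D m i - ratVecOf D n i) ^ 2 := by
  induction D generalizing m n with
  | zero => simp [sqc, ratOf_zero]
  | succ D ih =>
    rw [sqc, ratOf_addc, ratOf_mulc, ratOf_subc, ih, Fin.sum_univ_succ]
    simp only [ratVecOf_zero, ratVecOf_succ]
    ring

/-- Squared distances of rational points are rational, so distances can be compared with rationals
exactly, without square roots. -/
theorem dist_cen_sq (D m n : ℕ) : dist (cen D m) (cen D n) ^ 2 = (ratOf (sqc D m n) : ℝ) := by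
  rw [EuclideanSpace.dist_eq, Real.sq_sqrt (by positivity), ratOf_sqc]
  push_cast
  refine Finset.sum_congr rfl fun i _ => ?_
  simp [cen, Real.dist_eq, sq_abs]

theorem primrec_sqc (D : ℕ) : Primrec₂ (sqc D) := by
  induction D with
  | zero => exact Primrec.const 0
  | succ D ih =>
    have h1 := Primrec.fst (α := ℕ) (β := ℕ)
    have h2 := Primrec.snd (α := ℕ) (β := ℕ)
    have h3 := primrec_subc.comp (prim_left h1) (prim_left h2)
    exact primrec_addc.comp (primrec_mulc.comp h3 h3) (ih.comp (prim_right h1) (prim_right h2))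

/-- The test whether the distance of two rational points is below a rational number. -/
def near (D m n s : ℕ) : Bool := ltc 0 s && ltc (sqc D m n) (mulc s s)

theorem near_iff (D m n s : ℕ) :
    near D m n s = true ↔ dist (cen D m) (cen D n) < (ratOf s : ℝ) := by
  rw [near, Bool.and_eq_true, ltc_iff, ltc_iff, ratOf_zero, ratOf_mulc, ← Rat.cast_lt (K := ℝ),
    ← Rat.cast_lt (K := ℝ), ← dist_cen_sq]
  push_cast
  constructor
  · rintro ⟨h0, h⟩
    exact lt_of_pow_lt_pow_left₀ 2 h0.le (by rwa [sq (ratOf s : ℝ)])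
  · intro h
    have h0 := dist_nonneg.trans_lt h
    exact ⟨h0, by rw [← sq]; exact pow_lt_pow_left₀ h dist_nonneg two_ne_zero⟩

/-- The test whether the distance of two rational points is above a rational number. -/
def apart (D m n s : ℕ) : Bool := ltc s 0 || ltc (mulc s s) (sqc D m n)

theorem apart_iff (D m n s : ℕ) :
    apart D m n s = true ↔ (ratOf s : ℝ) < dist (cen D m) (cen D n) := by
  rw [apart, Bool.or_eq_true, ltc_iff, ltc_iff, ratOf_zero, ratOf_mulc, ← Rat.cast_lt (K := ℝ),
    ← Rat.cast_lt (K := ℝ), ← dist_cen_sq]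
  push_cast
  constructor
  · rintro (h | h)
    · exact h.trans_le dist_nonneg
    · exact lt_of_pow_lt_pow_left₀ 2 dist_nonneg (by rwa [sq (ratOf s : ℝ)])
  · intro h
    rcases lt_or_ge (ratOf s : ℝ) 0 with h0 | h0
    · exact .inl h0
    · exact .inr (by rw [← sq]; exact pow_lt_pow_left₀ h h0 two_ne_zero)

theorem primrec_near {α : Type*} [Primcodable α] (D : ℕ) {f g h : α → ℕ} (hf : Primrec f)
    (hg : Primrec g) (hh : Primrec h) : Primrec fun a => near D (f a) (g a) (h a) :=
  Primrec.and.comp (primrec_ltc.comp (Primrec.const 0) hh)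
    (primrec_ltc.comp ((primrec_sqc D).comp hf hg) (primrec_mulc.comp hh hh))

theorem primrec_apart {α : Type*} [Primcodable α] (D : ℕ) {f g h : α → ℕ} (hf : Primrec f)
    (hg : Primrec g) (hh : Primrec h) : Primrec fun a => apart D (f a) (g a) (h a) :=
  Primrec.or.comp (primrec_ltc.comp hh (Primrec.const 0))
    (primrec_ltc.comp (primrec_mulc.comp hh hh) ((primrec_sqc D).comp hf hg))

attribute [irreducible] near apart addc subc mulc ltc powc epsc natc

/-- The closed rational ball with code `κ`. -/
def cball (D κ : ℕ) : Set (EuclideanSpace ℝ (Fin D)) :=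
  Metric.closedBall (cen D κ.unpair.1) (ratOf κ.unpair.2 : ℝ)

theorem mem_ratBall {D b : ℕ} {x : EuclideanSpace ℝ (Fin D)} :
    x ∈ ratBall D b ↔ dist x (cen D b.unpair.1) < (ratOf b.unpair.2 : ℝ) := Iff.rfl

theorem mem_cball {D b : ℕ} {x : EuclideanSpace ℝ (Fin D)} :
    x ∈ cball D b ↔ dist x (cen D b.unpair.1) ≤ (ratOf b.unpair.2 : ℝ) := Iff.rfl

theorem ratBall_subset_cball (D b : ℕ) : ratBall D b ⊆ cball D b := Metric.ball_subset_closedBall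

theorem ratBall_zero (D : ℕ) : ratBall D 0 = ∅ := by
  ext x
  simp [mem_ratBall, ratOf_zero, dist_nonneg]

/-- A code of the empty closed ball. -/
def emptyc : ℕ := Nat.pair 0 (ratMk 0 1 0)

/-- The radius is -1, because a closed ball of radius 0 still contains its centre. -/
theorem cball_emptyc (D : ℕ) : cball D emptyc = ∅ := by
  ext x
  simp only [mem_cball, emptyc, Nat.unpair_pair, ratOf_ratMk, Set.mem_empty_iff_false, iff_false,
    not_le]
  exact lt_of_lt_of_le (by norm_num) dist_nonneg

/-- A test for the inclusion of a closed ball in an open one. -/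
def inc (D κ b : ℕ) : Bool := near D κ.unpair.1 b.unpair.1 (subc b.unpair.2 κ.unpair.2)

/-- A test for the disjointness of closed balls. -/
def far (D κ κ' : ℕ) : Bool := apart D κ.unpair.1 κ'.unpair.1 (addc κ.unpair.2 κ'.unpair.2)

/-- The open set of the points with names beginning with the list `l`. -/
def cone (D : ℕ) (l : List ℕ) : Set (EuclideanSpace ℝ (Fin D)) :=
  {x | ∀ m < l.length, dist x (cen D (l.getD m 0)) < (2 : ℝ)⁻¹ ^ m}

/-- A test for the inclusion of a closed ball in `cone D l`. -/
def incCone (D κ : ℕ) (l : List ℕ) : Bool :=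
  (List.range l.length).all fun m => near D κ.unpair.1 (l.getD m 0) (subc (powc m) κ.unpair.2)

theorem primrec_inc (D : ℕ) : Primrec₂ (inc D) :=
  primrec_near D (prim_left Primrec.fst) (prim_left Primrec.snd)
    (primrec_subc.comp (prim_right Primrec.snd) (prim_right Primrec.fst))

theorem primrec_far (D : ℕ) : Primrec₂ (far D) :=
  primrec_apart D (prim_left Primrec.fst) (prim_left Primrec.snd)
    (primrec_addc.comp (prim_right Primrec.fst) (prim_right Primrec.snd))

theorem TC.incCone {α : Type*} [Primcodable α] (D : ℕ) {K : Cantor → α → ℕ}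
    {L : Cantor → α → List ℕ} (hK : TC K) (hL : TC L) :
    TC fun q a => HyperSemi.incCone D (K q a) (L q a) := by
  have h : TC fun _ (x : (ℕ × List ℕ) × ℕ) =>
      near D x.1.1.unpair.1 (x.1.2.getD x.2 0) (subc (powc x.2) x.1.1.unpair.2) :=
    TC.of_primrec (primrec_near D (prim_left (Primrec.fst.comp Primrec.fst))
      ((Primrec.list_getD 0).comp (Primrec.snd.comp Primrec.fst) Primrec.snd)
      (primrec_subc.comp (primrec_powc.comp Primrec.snd)
        (prim_right (Primrec.fst.comp Primrec.fst))))
  have h' : TC fun _ (x : ℕ × List ℕ) => x.2.length := TC.id.snd.app Computable.list_length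
  have h2 : TC fun _ (x : ℕ × List ℕ) => HyperSemi.incCone D x.1 x.2 := TC.all h' h
  exact TC.comp h2 (hK.pair hL)

theorem cball_subset_of_inc {D κ b : ℕ} (h : inc D κ b = true) : cball D κ ⊆ ratBall D b := by
  rw [inc, near_iff, ratOf_subc] at h
  push_cast at h
  intro x hx
  rw [mem_cball] at hx
  rw [mem_ratBall]
  linarith [dist_triangle x (cen D κ.unpair.1) (cen D b.unpair.1)]

theorem notMem_of_far {D κ κ' : ℕ} (h : far D κ κ' = true) {x : EuclideanSpace ℝ (Fin D)}
    (hx : x ∈ cball D κ) : x ∉ cball D κ' := by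
  rw [far, apart_iff, ratOf_addc] at h
  push_cast at h
  rw [mem_cball] at hx ⊢
  have := dist_triangle_left (cen D κ.unpair.1) (cen D κ'.unpair.1) x
  intro h'
  linarith

theorem incCone_iff {D κ : ℕ} {l : List ℕ} : incCone D κ l = true ↔ ∀ m < l.length,
    dist (cen D κ.unpair.1) (cen D (l.getD m 0)) < (2 : ℝ)⁻¹ ^ m - ratOf κ.unpair.2 := by
  simp only [incCone, List.all_eq_true, List.mem_range, near_iff, ratOf_subc, ratOf_powc]
  push_cast
  rfl

theorem cball_subset_of_incCone {D κ : ℕ} {l : List ℕ} (h : incCone D κ l = true) :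
    cball D κ ⊆ cone D l := by
  rw [incCone_iff] at h
  intro x hx m hm
  rw [mem_cball] at hx
  linarith [h m hm, dist_triangle x (cen D κ.unpair.1) (cen D (l.getD m 0))]

/-- `κ` is a code of a ball of radius below `δ` around a point near `x`. -/
def Small {D : ℕ} (x : EuclideanSpace ℝ (Fin D)) (δ : ℝ) (κ : ℕ) : Prop :=
  x ∈ ratBall D κ ∧ (ratOf κ.unpair.2 : ℝ) < δ

theorem exists_small {D : ℕ} (x : EuclideanSpace ℝ (Fin D)) {δ : ℝ} (hδ : 0 < δ) :
    ∃ κ, Small x δ κ := by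
  obtain ⟨r, h0, hr⟩ := exists_rat_btwn hδ
  obtain ⟨n, rfl⟩ := ratOf_surjective r
  obtain ⟨m, hm⟩ := exists_cen_dist_lt x h0
  refine ⟨Nat.pair m n, ?_, ?_⟩
  · simpa [mem_ratBall] using hm
  · simpa using hr

/-- Half of the slack is enough: moving from x to the centre of κ costs less than one radius, and
the test subtracts one more. -/
theorem exists_inc {D b : ℕ} {x : EuclideanSpace ℝ (Fin D)} (hx : x ∈ ratBall D b) :
    ∃ δ : ℝ, 0 < δ ∧ ∀ κ, Small x δ κ → inc D κ b = true := by
  rw [mem_ratBall] at hx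
  refine ⟨(ratOf b.unpair.2 - dist x (cen D b.unpair.1)) / 2, by linarith, ?_⟩
  rintro κ ⟨h1, h2⟩
  rw [mem_ratBall] at h1
  rw [inc, near_iff, ratOf_subc]
  push_cast
  linarith [dist_triangle_left (cen D κ.unpair.1) (cen D b.unpair.1) x]

theorem exists_far {D κ' : ℕ} {x : EuclideanSpace ℝ (Fin D)} (hx : x ∉ cball D κ') :
    ∃ δ : ℝ, 0 < δ ∧ ∀ κ, Small x δ κ → far D κ κ' = true := by
  rw [mem_cball, not_le] at hx
  refine ⟨(dist x (cen D κ'.unpair.1) - ratOf κ'.unpair.2) / 2, by linarith, ?_⟩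
  rintro κ ⟨h1, h2⟩
  rw [mem_ratBall] at h1
  rw [far, apart_iff, ratOf_addc]
  push_cast
  linarith [dist_triangle x (cen D κ.unpair.1) (cen D κ'.unpair.1)]

/-- A list imposes only finitely many strict inequalities, so the minimum of the half slacks works.
-/
theorem exists_incCone {D : ℕ} {l : List ℕ} {x : EuclideanSpace ℝ (Fin D)} (hx : x ∈ cone D l) :
    ∃ δ : ℝ, 0 < δ ∧ ∀ κ, Small x δ κ → incCone D κ l = true := by
  have key : ∀ n ≤ l.length, ∃ δ : ℝ, 0 < δ ∧ ∀ κ, Small x δ κ → ∀ m < n,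
      dist (cen D κ.unpair.1) (cen D (l.getD m 0)) < (2 : ℝ)⁻¹ ^ m - ratOf κ.unpair.2 := by
    intro n
    induction n with
    | zero => exact fun _ => ⟨1, one_pos, by simp⟩
    | succ n ih =>
      intro hn
      obtain ⟨δ, hδ, h⟩ := ih (by omega)
      have hxn := hx n (by omega)
      refine ⟨min δ (((2 : ℝ)⁻¹ ^ n - dist x (cen D (l.getD n 0))) / 2),
        lt_min hδ (by linarith), fun κ hκ m hm => ?_⟩
      obtain ⟨h1, h2⟩ := hκ
      rcases Nat.lt_succ_iff_lt_or_eq.1 hm with hm | rfl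
      · exact h κ ⟨h1, h2.trans_le (min_le_left _ _)⟩ m hm
      · have h3 := h2.trans_le (min_le_right _ _)
        rw [mem_ratBall] at h1
        linarith [dist_triangle_left (cen D κ.unpair.1) (cen D (l.getD m 0)) x]
  obtain ⟨δ, hδ, h⟩ := key l.length le_rfl
  exact ⟨δ, hδ, fun κ hκ => incCone_iff.2 (h κ hκ)⟩

/-! ### Operations on names of Borel sets -/

/-- The string encoding the sequence `a`. -/
def charStr (a : ℕ → ℕ) : Cantor := fun t => decide (t.unpair.2 = a t.unpair.1)

theorem codes_charStr (a : ℕ → ℕ) : Codes (charStr a) a := fun n k => by simp [charStr]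

theorem Codes.eq_charStr {p : Cantor} {a : ℕ → ℕ} (h : Codes p a) : p = charStr a := by
  funext t
  rw [Bool.eq_iff_iff, charStr, decide_eq_true_iff, ← h, Nat.pair_unpair]

theorem TC.charStr {α : Type*} [Primcodable α] {F : Cantor → α × ℕ → ℕ} {T : Cantor → α → ℕ}
    (hF : TC F) (hT : TC T) : TC fun q a => HyperSemi.charStr (fun n => F q (a, n)) (T q a) :=
  TC.decideEq hT.right (hF.comp (TC.id.pair hT.left))

/-- A name of the union of a sequence of sets. -/
def iUnionName (P : ℕ → Cantor) : Cantor := fun t =>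
  P t.unpair.1.unpair.1 (Nat.pair t.unpair.1.unpair.2 t.unpair.2)

/-- A name of the union of two sets. -/
def unionName (p q : Cantor) : Cantor := iUnionName fun j => if decide (j = 0) = true then p else q

section Names

variable {D : ℕ} {X : Set (EuclideanSpace ℝ (Fin D))}

theorem thetaLower_charStr {a : ℕ → ℕ} {U : Set (EuclideanSpace ℝ (Fin D))}
    (h : U = ⋃ m, ratBall D (a m)) : thetaLower D (charStr a) U := ⟨a, codes_charStr a, h⟩

/-- A double sequence, of balls in the lowest class and of sets in the others, is rearranged by
pairing into a single one, so no level is lost. -/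
theorem sigmaRep_iUnionName {d : ℕ} {P : ℕ → Cantor} {S : ℕ → Set X}
    (h : ∀ j, sigmaRep X (d + 1) (P j) (S j)) :
    sigmaRep X (d + 1) (iUnionName P) (⋃ j, S j) := by
  cases d with
  | zero =>
    choose a ha ha' using h
    have h1 : iUnionName P = charStr fun n => a n.unpair.1 n.unpair.2 := by
      funext t
      simp [iUnionName, (ha _).eq_charStr, charStr]
    change thetaLower D _ _
    rw [h1, Set.image_iUnion]
    refine thetaLower_charStr ?_
    ext x
    simp only [Set.mem_iUnion, ha']
    constructor
    · rintro ⟨j, m, h⟩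
      exact ⟨Nat.pair j m, by simpa using h⟩
    · rintro ⟨n, h⟩
      exact ⟨_, _, h⟩
  | succ d =>
    choose T hT hS using h
    refine ⟨fun n => T n.unpair.1 n.unpair.2, fun n => ?_, ?_⟩
    · have := hT n.unpair.1 n.unpair.2
      convert this using 1
      funext k
      simp [component, iUnionName]
    · ext x
      simp only [hS, Set.mem_iUnion]
      constructor
      · rintro ⟨j, m, h⟩
        exact ⟨Nat.pair j m, by simpa using h⟩
      · rintro ⟨n, h⟩
        exact ⟨_, _, h⟩

theorem sigmaRep_unionName {d : ℕ} {p q : Cantor} {S T : Set X} (hp : sigmaRep X (d + 1) p S)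
    (hq : sigmaRep X (d + 1) q T) : sigmaRep X (d + 1) (unionName p q) (S ∪ T) := by
  have h := sigmaRep_iUnionName (P := fun j => if decide (j = 0) = true then p else q)
    (S := fun j => if j = 0 then S else T) (d := d) (X := X) fun j => by
      by_cases hj : j = 0 <;> simp [hj, hp, hq]
  have hU : S ∪ T = ⋃ j, if j = 0 then S else T := ?_
  · rw [hU]
    exact h
  ext x
  simp only [Set.mem_union, Set.mem_iUnion]
  constructor
  · rintro (h | h)
    · exact ⟨0, by simpa using h⟩
    · exact ⟨1, by simpa using h⟩
  · rintro ⟨j, h⟩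
    by_cases hj : j = 0
    · exact .inl (by simpa [hj] using h)
    · exact .inr (by simpa [hj] using h)

/-- The symbols of `p` list balls that cover `X`. -/
def Covers (X : Set (EuclideanSpace ℝ (Fin D))) (p : Cantor) : Prop :=
  ∀ x, x ∈ X ↔ ∃ e, p e = true ∧ x ∈ ratBall D e.unpair.2

/-- Only the positions of the symbols 1 matter, so the cover can be searched symbol by symbol
without decoding the sequence of balls. -/
theorem covers_of_thetaLower {p : Cantor} (h : thetaLower D p X) : Covers X p := by
  obtain ⟨a, ha, rfl⟩ := h
  intro x
  rw [Set.mem_iUnion]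
  constructor
  · rintro ⟨i, hi⟩
    exact ⟨Nat.pair i (a i), (ha _ _).2 rfl, by simpa using hi⟩
  · rintro ⟨e, he, hx⟩
    rw [← Nat.pair_unpair e, ha] at he
    exact ⟨e.unpair.1, he ▸ hx⟩

variable (D) in
/-- A name of the complement of a closed ball as a set of the class number `d + 1`. -/
def coballName (pX : Cantor) : ℕ → ℕ → Cantor
  | 0, κ => charStr fun n =>
      if (pX n.unpair.2 && inc D n.unpair.1 n.unpair.2.unpair.2 && far D n.unpair.1 κ) = true
      then n.unpair.1 else 0
  | d + 1, κ => fun t =>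
      coballName pX d (if far D t.unpair.1 κ = true then t.unpair.1 else emptyc) t.unpair.2

/-- In the lowest class the open balls are listed that provably lie in X and are separated from κ.
Higher up, the complement is exhausted by closed balls separated from κ, and these are complements
of sets of the preceding class; rejected candidates become the empty ball. -/
theorem sigmaRep_coballName {pX : Cantor} (hX : Covers X pX) (d κ : ℕ) :
    sigmaRep X (d + 1) (coballName D pX d κ) {x | x.1 ∉ cball D κ} := by
  induction d generalizing κ with
  | zero =>
    change thetaLower D _ _
    refine thetaLower_charStr ?_
    ext x
    simp only [Set.mem_image, Set.mem_ofPred_eq, Set.mem_iUnion, Subtype.exists]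
    constructor
    · rintro ⟨x, hx, h, rfl⟩
      obtain ⟨e, he, hxe⟩ := (hX x).1 hx
      obtain ⟨δ₁, h₁, H₁⟩ := exists_inc hxe
      obtain ⟨δ₂, h₂, H₂⟩ := exists_far h
      obtain ⟨b, hb, hb'⟩ := exists_small x (lt_min h₁ h₂)
      refine ⟨Nat.pair b e, ?_⟩
      simp [he, H₁ b ⟨hb, hb'.trans_le (min_le_left _ _)⟩,
        H₂ b ⟨hb, hb'.trans_le (min_le_right _ _)⟩, hb]
    · rintro ⟨n, hn⟩
      split_ifs at hn with h
      · simp only [Bool.and_eq_true] at h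
        have hn' := ratBall_subset_cball _ _ hn
        exact ⟨x, (hX x).2 ⟨_, h.1.1, cball_subset_of_inc h.1.2 hn'⟩, notMem_of_far h.2 hn', rfl⟩
      · rw [ratBall_zero] at hn
        exact hn.elim
  | succ d ih =>
    refine ⟨fun m => {x | x.1 ∉ cball D (if far D m κ = true then m else emptyc)}, fun m => ?_, ?_⟩
    · convert ih (if far D m κ = true then m else emptyc) using 1
      funext k
      simp [component, coballName]
    · ext x
      simp only [Set.mem_ofPred_eq, Set.mem_iUnion, Set.mem_compl_iff, not_not]
      constructor
      · intro h
        obtain ⟨δ, h₂, H₂⟩ := exists_far h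
        obtain ⟨b, hb⟩ := exists_small x.1 h₂
        exact ⟨b, by rw [if_pos (H₂ b hb)]; exact ratBall_subset_cball _ _ hb.1⟩
      · rintro ⟨m, hm⟩
        split_ifs at hm with h
        · exact notMem_of_far h hm
        · rw [cball_emptyc] at hm
          exact hm.elim

/-- The condition of rank `d` reached from the list `l`, over the point `x`, for a table `R` of
conditions that are decided by finite lists. -/
def Reach (x : EuclideanSpace ℝ (Fin D)) (R : List ℕ → List ℕ → Bool) :
    ℕ → List ℕ → List ℕ → Prop
  | 0, idx, l => ∃ e, x ∈ cone D (l ++ e) ∧ R idx (l ++ e) = true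
  | d + 1, idx, l => ∃ m e, x ∈ cone D (l ++ e) ∧ ¬ Reach x R d (m :: idx) (l ++ e)

/-- The extension of `l` number `n`. -/
def extend (l : List ℕ) (n : ℕ) : List ℕ := l ++ Denumerable.ofNat (List ℕ) n

theorem extend_encode (l e : List ℕ) : extend l (Encodable.encode e) = l ++ e := by
  simp [extend]

variable (D) in
/-- A name of the set of the points over which a condition is reached. -/
def reachName (pX : Cantor) (R : List ℕ → List ℕ → Bool) : ℕ → List ℕ → List ℕ → Cantor
  | 0, idx, l => charStr fun n =>
      if (pX n.unpair.2.unpair.1 && inc D n.unpair.1 n.unpair.2.unpair.1.unpair.2 &&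
        (incCone D n.unpair.1 (extend l n.unpair.2.unpair.2) &&
          R idx (extend l n.unpair.2.unpair.2))) = true
      then n.unpair.1 else 0
  | d + 1, idx, l => fun t =>
      unionName (coballName D pX d
          (if incCone D t.unpair.1.unpair.2.unpair.2
            (extend l t.unpair.1.unpair.2.unpair.1) = true
          then t.unpair.1.unpair.2.unpair.2 else emptyc))
        (reachName pX R d (t.unpair.1.unpair.1 :: idx) (extend l t.unpair.1.unpair.2.unpair.1))
        t.unpair.2

/-- In the successor step the open cone is exhausted by closed balls passing `incCone`. The part of
such a ball where the inner condition is not reached is the complement of the union of the coball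
and the inner set, both of the preceding class. -/
theorem sigmaRep_reachName {pX : Cantor} (hX : Covers X pX) (R : List ℕ → List ℕ → Bool) (d : ℕ)
    (idx l : List ℕ) :
    sigmaRep X (d + 1) (reachName D pX R d idx l) {x | Reach x.1 R d idx l} := by
  induction d generalizing idx l with
  | zero =>
    change thetaLower D _ _
    refine thetaLower_charStr ?_
    ext x
    simp only [Set.mem_image, Set.mem_ofPred_eq, Set.mem_iUnion, Subtype.exists, Reach]
    constructor
    · rintro ⟨x, hx, ⟨e', hc, hR⟩, rfl⟩
      obtain ⟨e, he, hxe⟩ := (hX x).1 hx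
      obtain ⟨δ₁, h₁, H₁⟩ := exists_inc hxe
      obtain ⟨δ₂, h₂, H₂⟩ := exists_incCone hc
      obtain ⟨b, hb, hb'⟩ := exists_small x (lt_min h₁ h₂)
      refine ⟨Nat.pair b (Nat.pair e (Encodable.encode e')), ?_⟩
      simp [he, H₁ b ⟨hb, hb'.trans_le (min_le_left _ _)⟩, extend_encode,
        H₂ b ⟨hb, hb'.trans_le (min_le_right _ _)⟩, hb, hR]
    · rintro ⟨n, hn⟩
      split_ifs at hn with h
      · simp only [Bool.and_eq_true] at h
        have hn' := ratBall_subset_cball _ _ hn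
        exact ⟨x, (hX x).2 ⟨_, h.1.1, cball_subset_of_inc h.1.2 hn'⟩,
          ⟨_, cball_subset_of_incCone h.2.1 hn', h.2.2⟩, rfl⟩
      · rw [ratBall_zero] at hn
        exact hn.elim
  | succ d ih =>
    refine ⟨fun n => {x | x.1 ∉ cball D (if incCone D n.unpair.2.unpair.2
        (extend l n.unpair.2.unpair.1) = true then n.unpair.2.unpair.2 else emptyc)} ∪
        {x | Reach x.1 R d (n.unpair.1 :: idx) (extend l n.unpair.2.unpair.1)}, fun n => ?_, ?_⟩
    · convert sigmaRep_unionName (sigmaRep_coballName hX d (if incCone D n.unpair.2.unpair.2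
        (extend l n.unpair.2.unpair.1) = true then n.unpair.2.unpair.2 else emptyc))
        (ih (n.unpair.1 :: idx) (extend l n.unpair.2.unpair.1)) using 1
      funext k
      simp [component, reachName]
    · ext x
      simp only [Set.mem_ofPred_eq, Set.mem_iUnion, Set.mem_compl_iff, not_not, Set.mem_union,
        not_or, Reach]
      constructor
      · rintro ⟨m, e, hc, h⟩
        obtain ⟨δ, h₂, H₂⟩ := exists_incCone hc
        obtain ⟨b, hb⟩ := exists_small x.1 h₂
        refine ⟨Nat.pair m (Nat.pair (Encodable.encode e) b), ?_⟩
        simp [extend_encode, H₂ b hb, h, ratBall_subset_cball _ _ hb.1]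
      · rintro ⟨n, hn, h⟩
        split_ifs at hn with h'
        · exact ⟨_, _, cball_subset_of_incCone h' hn, h⟩
        · rw [cball_emptyc] at hn
          exact hn.elim

end Names

/-! ### Computability of the operations on names. -/

section TC

variable {α : Type*} [Primcodable α]

theorem TC.iUnionName {P : Cantor → (α × ℕ) × ℕ → Bool} (hP : TC P) {T : Cantor → α → ℕ}
    (hT : TC T) :
    TC fun q a => HyperSemi.iUnionName (fun j t => P q ((a, j), t)) (T q a) :=
  hP.comp ((TC.id.pair hT.left.left).pair (hT.left.right.natPair hT.right))

theorem TC.unionName {P Q : Cantor → α × ℕ → Bool} (hP : TC P) (hQ : TC Q)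
    {T : Cantor → α → ℕ} (hT : TC T) :
    TC fun q a => HyperSemi.unionName (fun t => P q (a, t)) (fun t => Q q (a, t)) (T q a) := by
  have h : TC fun q (x : (α × ℕ) × ℕ) =>
      if decide (x.1.2 = 0) = true then P q (x.1.1, x.2) else Q q (x.1.1, x.2) :=
    TC.ite (TC.decideEq TC.id.fst.snd (TC.const 0)) (hP.comp (TC.id.fst.fst.pair TC.id.snd))
      (hQ.comp (TC.id.fst.fst.pair TC.id.snd))
  have h' := TC.iUnionName h hT
  convert h' using 4 with q a j
  unfold HyperSemi.unionName
  congr 1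
  funext j t
  split_ifs <;> rfl

theorem TC.extend {L : Cantor → α → List ℕ} {N : Cantor → α → ℕ} (hL : TC L) (hN : TC N) :
    TC fun q a => HyperSemi.extend (L q a) (N q a) :=
  hL.app₂ Computable.list_append (hN.app (Computable.ofNat (List ℕ)))

theorem TC.coballName {D : ℕ} {pX : Cantor} (hpX : Computable pX) (d : ℕ)
    {K T : Cantor → α → ℕ} (hK : TC K) (hT : TC T) :
    TC fun q a => HyperSemi.coballName D pX d (K q a) (T q a) := by
  induction d generalizing K T with
  | zero =>
    refine TC.charStr (F := fun q x => if (pX x.2.unpair.2 &&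
      inc D x.2.unpair.1 x.2.unpair.2.unpair.2 && far D x.2.unpair.1 (K q x.1)) = true
      then x.2.unpair.1 else 0) ?_ hT
    have hn : TC fun _ (x : α × ℕ) => x.2 := TC.id.snd
    exact TC.ite (((hn.right.app hpX).and (hn.left.app₂ (primrec_inc D).to_comp
      hn.right.right)).and (hn.left.app₂ (primrec_far D).to_comp (hK.comp TC.id.fst)))
      hn.left (TC.const 0)
  | succ d ih =>
    exact ih (TC.ite (hT.left.app₂ (primrec_far D).to_comp hK) hT.left (TC.const emptyc))
      hT.right

theorem TC.reachName {D : ℕ} {pX : Cantor} (hpX : Computable pX)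
    {R : Cantor → α × List ℕ × List ℕ → Bool} (hR : TC R) (d : ℕ) :
    TC fun q (x : (α × List ℕ × List ℕ) × ℕ) =>
      HyperSemi.reachName D pX (fun idx l => R q (x.1.1, idx, l)) d x.1.2.1 x.1.2.2 x.2 := by
  induction d with
  | zero =>
    refine TC.charStr (F := fun q (y : ((α × List ℕ × List ℕ) × ℕ) × ℕ) =>
      if (pX y.2.unpair.2.unpair.1 && inc D y.2.unpair.1 y.2.unpair.2.unpair.1.unpair.2 &&
        (HyperSemi.incCone D y.2.unpair.1 (HyperSemi.extend y.1.1.2.2 y.2.unpair.2.unpair.2) &&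
          R q (y.1.1.1, y.1.1.2.1, HyperSemi.extend y.1.1.2.2 y.2.unpair.2.unpair.2))) = true
      then y.2.unpair.1 else 0) ?_ TC.id.snd
    have hn : TC fun _ (y : ((α × List ℕ × List ℕ) × ℕ) × ℕ) => y.2 := TC.id.snd
    have hx : TC fun _ (y : ((α × List ℕ × List ℕ) × ℕ) × ℕ) => y.1.1 := TC.id.fst.fst
    have hl := TC.extend hx.snd.snd hn.right.right
    exact TC.ite (((hn.right.left.app hpX).and (hn.left.app₂ (primrec_inc D).to_comp
      hn.right.left.right)).and ((TC.incCone D hn.left hl).and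
        (hR.comp (hx.fst.pair (hx.snd.fst.pair hl))))) hn.left (TC.const 0)
  | succ d ih =>
    have hn : TC fun _ (x : ((α × List ℕ × List ℕ) × ℕ) × ℕ) => x.1.2 := TC.id.fst.snd
    have hx : TC fun _ (x : ((α × List ℕ × List ℕ) × ℕ) × ℕ) => x.1.1 := TC.id.fst.fst
    have hs : TC fun _ (x : ((α × List ℕ × List ℕ) × ℕ) × ℕ) => x.2 := TC.id.snd
    have hl := TC.extend hx.snd.snd hn.left.right.left
    have hκ := hn.left.right.right
    have hT : TC fun _ (x : (α × List ℕ × List ℕ) × ℕ) => x.2.unpair.2 := TC.id.snd.right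
    have h1 := TC.coballName (D := D) hpX d
      (TC.ite (TC.incCone D hκ hl) hκ (TC.const emptyc)) hs
    have h2 := ih.comp ((hx.fst.pair ((hn.left.left.app₂ Computable.list_cons hx.snd.fst).pair
      hl)).pair hs)
    exact TC.unionName h1 h2 hT

end TC

/-! ### Generic names -/

/-- The alternating formula `∃ m₁ ¬ ∃ m₂ ¬ … P [m_d, …, m₁]`. -/
def altSat (P : List ℕ → Prop) : ℕ → List ℕ → Prop
  | 0, idx => P idx
  | d + 1, idx => ∃ m, ¬ altSat P d (m :: idx)

theorem pre_length {α : Type*} (a : ℕ → α) (n : ℕ) : (pre a n).length = n := by simp [pre]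

theorem pre_add {α : Type*} (a : ℕ → α) (m n : ℕ) :
    pre a (m + n) = pre a m ++ pre (fun i => a (m + i)) n := by
  simp [pre, List.range_add, Function.comp_def]

theorem exists_pre_eq_append {α : Type*} (a : ℕ → α) {m n : ℕ} (h : m ≤ n) :
    ∃ e, pre a n = pre a m ++ e := by
  obtain ⟨k, rfl⟩ := Nat.exists_eq_add_of_le h
  exact ⟨_, pre_add a m k⟩

/-- A sequence that meets countably many dense sets of finite conditions. -/
theorem exists_generic {P : List ℕ → Prop} (hP : ∀ l e, P (l ++ e) → P l)
    (hext : ∀ l, P l → ∃ c, P (l ++ [c])) {Q : ℕ → List ℕ → Prop}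
    (hQ : ∀ k l, P l → ∃ e, P (l ++ e) ∧ Q k (l ++ e)) {l₀ : List ℕ} (h₀ : P l₀) :
    ∃ a : ℕ → ℕ, pre a l₀.length = l₀ ∧ (∀ n, P (pre a n)) ∧ ∀ k, ∃ n, Q k (pre a n) := by
  choose! ext hext using hext
  choose! gen hgen hgen' using hQ
  -- Stage k meets the k-th dense set and then appends one more entry, so that the lengths tend to
  -- infinity even if the dense set is met at once.
  let L : ℕ → List ℕ := fun n =>
    Nat.rec l₀ (fun k l => l ++ gen k l ++ [ext (l ++ gen k l)]) n
  have hL : ∀ k, L (k + 1) = L k ++ gen k (L k) ++ [ext (L k ++ gen k (L k))] := fun _ => rfl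
  have hPL : ∀ k, P (L k) := fun k => by
    induction k with
    | zero => exact h₀
    | succ k ih => exact hext _ (hgen k _ ih)
  have hlen : ∀ k, k ≤ (L k).length := fun k => by
    induction k with
    | zero => exact Nat.zero_le _
    | succ k ih => rw [hL]; simp; omega
  have hpre : ∀ k n, L k <+: L (k + n) := fun k n => by
    induction n with
    | zero => exact List.prefix_rfl
    | succ n ih =>
      refine ih.trans ?_
      rw [← add_assoc, hL, List.append_assoc]
      exact List.prefix_append _ _
  let a : ℕ → ℕ := fun n => (L (n + 1)).getD n 0
  have key : ∀ k l, l <+: L k → pre a l.length = l := by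
    intro k l hl
    refine List.ext_getElem (pre_length _ _) fun n h1 h2 => ?_
    have e1 : (pre a l.length)[n] = a n := by simp [pre]
    rw [e1]
    have h3 : n < (L (n + 1)).length := hlen (n + 1)
    have e2 : a n = (L (n + 1))[n] := List.getD_eq_getElem _ _ h3
    rw [e2]
    have h4 := hl.trans (hpre k (n + 1))
    have h5 : L (n + 1) <+: L (k + (n + 1)) := by
      have := hpre (n + 1) k
      rwa [add_comm (n + 1) k] at this
    rw [h4.getElem h2, h5.getElem h3]
  refine ⟨a, key 0 l₀ List.prefix_rfl, fun n => ?_, fun k => ⟨(L k ++ gen k (L k)).length, ?_⟩⟩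
  · obtain ⟨e, he⟩ := exists_pre_eq_append a (hlen n)
    refine hP _ e ?_
    rw [← he, key n _ List.prefix_rfl]
    exact hPL n
  · rw [key (k + 1) (L k ++ gen k (L k))]
    · exact hgen' k _ (hPL k)
    · rw [hL]
      exact List.prefix_append _ _

/-! ### Forcing with finite lists compatible with a point. -/

variable {D : ℕ} {x : EuclideanSpace ℝ (Fin D)}

theorem mem_cone_of_append {l e : List ℕ} (h : x ∈ cone D (l ++ e)) : x ∈ cone D l := by
  intro m hm
  have := h m (by simp; omega)
  rwa [List.getD_append _ _ _ _ hm] at this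

theorem exists_mem_cone_concat {l : List ℕ} (h : x ∈ cone D l) : ∃ c, x ∈ cone D (l ++ [c]) := by
  obtain ⟨c, hc⟩ := exists_cen_dist_lt x (show (0 : ℝ) < 2⁻¹ ^ l.length by positivity)
  refine ⟨c, fun m hm => ?_⟩
  rcases lt_or_eq_of_le (show m ≤ l.length by simpa [Nat.lt_succ_iff] using hm) with hm | rfl
  · rw [List.getD_append _ _ _ _ hm]
    exact h m hm
  · simpa [List.getD_append_right] using hc

/-- The finite list `l` forces a condition. -/
def Forces (x : EuclideanSpace ℝ (Fin D)) (R : List ℕ → List ℕ → Bool) :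
    ℕ → List ℕ → List ℕ → Prop
  | 0, idx, l => R idx l = true
  | d + 1, idx, l => ∃ m, ¬ Reach x R d (m :: idx) l

variable {R : List ℕ → List ℕ → Bool}

/-- This reads both clauses of the recursion uniformly. Hence shortening a list preserves being
reached, while extending it preserves forcing. -/
theorem reach_iff_forces {d : ℕ} {idx l : List ℕ} :
    Reach x R d idx l ↔ ∃ e, x ∈ cone D (l ++ e) ∧ Forces x R d idx (l ++ e) := by
  cases d with
  | zero => rfl
  | succ d =>
    constructor
    · rintro ⟨m, e, h1, h2⟩
      exact ⟨e, h1, m, h2⟩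
    · rintro ⟨e, h1, m, h2⟩
      exact ⟨m, e, h1, h2⟩

theorem reach_of_append {d : ℕ} {idx l e : List ℕ} (h : Reach x R d idx (l ++ e)) :
    Reach x R d idx l := by
  obtain ⟨e', h1, h2⟩ := reach_iff_forces.1 h
  rw [List.append_assoc] at h1 h2
  exact reach_iff_forces.2 ⟨_, h1, h2⟩

theorem forces_append (hR : ∀ idx l e, R idx l = true → R idx (l ++ e) = true) {d : ℕ}
    {idx l e : List ℕ} (h : Forces x R d idx l) : Forces x R d idx (l ++ e) := by
  cases d with
  | zero => exact hR _ _ _ h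
  | succ d =>
    obtain ⟨m, hm⟩ := h
    exact ⟨m, fun h' => hm (reach_of_append h')⟩

/-- A name-independent property that is decided on names by an alternating formula holds if and
only if it is reached. -/
theorem reach_iff (hR : ∀ idx l e, R idx l = true → R idx (l ++ e) = true) {d : ℕ} {φ : Prop}
    (hφ : ∀ a : ℕ → ℕ, (∀ n, x ∈ cone D (pre a n)) →
      (φ ↔ altSat (fun idx => ∃ n, R idx (pre a n) = true) d [])) :
    Reach x R d [] [] ↔ φ := by
  -- There are countably many pairs of a rank and a stack of choices, and for each pair the lists
  -- that decide it are dense: either some compatible extension forces it or none does.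
  have gen : ∀ l₀, x ∈ cone D l₀ → ∃ a : ℕ → ℕ, pre a l₀.length = l₀ ∧
      (∀ n, x ∈ cone D (pre a n)) ∧ ∀ d idx, (∃ n, Forces x R d idx (pre a n)) ∨
        ∃ n, ¬ Reach x R d idx (pre a n) := by
    intro l₀ h₀
    have dense : ∀ (k : ℕ) (l : List ℕ), x ∈ cone D l → ∃ e, x ∈ cone D (l ++ e) ∧
        (Forces x R k.unpair.1 (Denumerable.ofNat (List ℕ) k.unpair.2) (l ++ e) ∨
          ¬ Reach x R k.unpair.1 (Denumerable.ofNat (List ℕ) k.unpair.2) (l ++ e)) := by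
      intro k l hl
      by_cases h : Reach x R k.unpair.1 (Denumerable.ofNat (List ℕ) k.unpair.2) l
      · obtain ⟨e, h1, h2⟩ := reach_iff_forces.1 h
        exact ⟨e, h1, .inl h2⟩
      · exact ⟨[], by simpa using hl, .inr (by simpa using h)⟩
    obtain ⟨a, h1, h2, h3⟩ := exists_generic (P := fun l => x ∈ cone D l)
      (Q := fun k l => Forces x R k.unpair.1 (Denumerable.ofNat (List ℕ) k.unpair.2) l ∨
        ¬ Reach x R k.unpair.1 (Denumerable.ofNat (List ℕ) k.unpair.2) l)
      (fun _ _ => mem_cone_of_append) (fun _ => exists_mem_cone_concat) dense h₀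
    refine ⟨a, h1, h2, fun d idx => ?_⟩
    obtain ⟨n, hn⟩ := h3 (Nat.pair d (Encodable.encode idx))
    simp only [Nat.unpair_pair, Denumerable.ofNat_encode] at hn
    exact hn.imp (fun h => ⟨n, h⟩) fun h => ⟨n, h⟩
  -- The truth lemma: along a deciding name, a formula holds exactly if some prefix forces it.
  -- Genericity is needed to pass through the negation.
  have truth : ∀ a : ℕ → ℕ, (∀ n, x ∈ cone D (pre a n)) →
      (∀ d idx, (∃ n, Forces x R d idx (pre a n)) ∨ ∃ n, ¬ Reach x R d idx (pre a n)) →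
      ∀ d idx, altSat (fun idx => ∃ n, R idx (pre a n) = true) d idx ↔
        ∃ n, Forces x R d idx (pre a n) := by
    intro a ha hgen d
    induction d with
    | zero => exact fun _ => Iff.rfl
    | succ d ih =>
      intro idx
      constructor
      · rintro ⟨m, hm⟩
        rw [ih] at hm
        obtain ⟨n, hn⟩ := (hgen d (m :: idx)).resolve_left hm
        exact ⟨n, m, hn⟩
      -- Two prefixes of one name are comparable; the longer one would force what the shorter one
      -- excludes.
      · rintro ⟨n, m, hm⟩
        refine ⟨m, fun h => hm ?_⟩
        obtain ⟨k, hk⟩ := (ih _).1 h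
        obtain ⟨e, he⟩ := exists_pre_eq_append a (le_max_left n k)
        obtain ⟨e', he'⟩ := exists_pre_eq_append a (le_max_right n k)
        refine reach_iff_forces.2 ⟨e, ?_, ?_⟩
        · rw [← he]
          exact ha _
        · rw [← he, he']
          exact forces_append hR hk
  constructor
  · intro h
    obtain ⟨e, h1, h2⟩ := reach_iff_forces.1 h
    -- The generic name is taken through the forcing list; `hφ` then transfers the truth found along
    -- this one name to `φ`.
    obtain ⟨a, ha, ha', hgen⟩ := gen _ h1
    rw [hφ a ha', truth a ha' hgen]
    exact ⟨_, by rw [ha]; exact h2⟩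
  · intro h
    obtain ⟨a, -, ha', hgen⟩ := gen [] (fun m hm => by simp at hm)
    obtain ⟨n, hn⟩ := (truth a ha' hgen d []).1 ((hφ a ha').1 h)
    exact reach_iff_forces.2 ⟨pre a n, by simpa using ha' n, by simpa using hn⟩

/-! ### Alternating limits -/

/-- The reflection t ↦ c - t exchanges suprema and infima, so one induction serves both kinds of
limits. -/
theorem lt_altLimit_sub_iff (d : ℕ) (h : ℕ → ℚ) (c y : ℚ) :
    ((y : ℝ) : EReal) < altLimit d true (fun n => c - h n) ↔
      altLimit d false h < (((c - y : ℚ) : ℝ) : EReal) := by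
  induction d generalizing h c y with
  | zero =>
    simp only [altLimit, lt_iSup_iff, iInf_lt_iff, EReal.coe_lt_coe_iff, Rat.cast_lt]
    exact exists_congr fun n => ⟨fun h => by linarith, fun h => by linarith⟩
  | succ d ih =>
    simp only [altLimit, lt_iSup_iff, iInf_lt_iff]
    refine exists_congr fun m => ?_
    have key : ∀ z : ℚ, altLimit d false (fun n => c - h (Nat.pair m n)) < ((z : ℝ) : EReal) ↔
        (((c - z : ℚ) : ℝ) : EReal) < altLimit d true (fun n => h (Nat.pair m n)) := by
      intro z
      have := ih (fun n => c - h (Nat.pair m n)) c (c - z)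
      simpa only [sub_sub_cancel] using this.symm
    constructor
    · intro hy
      -- Negating the induction hypothesis gives only weak inequalities; a rational in between
      -- restores strictness.
      obtain ⟨z, hz, hz'⟩ := EReal.exists_rat_btwn_of_lt hy
      have hz : (y : ℝ) < z := by exact_mod_cast hz
      have hz'' := mt (key z).2 hz'.not_gt
      refine (not_lt.1 hz'').trans_lt ?_
      exact_mod_cast (by push_cast; linarith : ((c - z : ℚ) : ℝ) < ((c - y : ℚ) : ℝ))
    · intro hy
      obtain ⟨z, hz, hz'⟩ := EReal.exists_rat_btwn_of_lt hy
      have hz' : (z : ℝ) < ((c - y : ℚ) : ℝ) := by exact_mod_cast hz'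
      have hz'' := mt (key (c - z)).1 (by rw [sub_sub_cancel]; exact hz.not_gt)
      refine lt_of_lt_of_le ?_ (not_lt.1 hz'')
      push_cast at hz'
      exact_mod_cast (by push_cast; linarith : (y : ℝ) < ((c - z : ℚ) : ℝ))

/-- A translation is a composition of two reflections. -/
theorem pos_altLimit_sub_iff (d : ℕ) (h : ℕ → ℚ) (u : ℚ) :
    0 < altLimit d true (fun n => h n - u) ↔ ((u : ℝ) : EReal) < altLimit d true h := by
  have h1 := lt_altLimit_sub_iff d (fun n => - h n) (-u) 0
  have h2 := lt_altLimit_sub_iff d (fun n => - h n) 0 u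
  simp only [zero_sub, neg_neg, sub_zero, Rat.cast_zero, EReal.coe_zero] at h1 h2
  rw [h2, ← h1]
  simp only [sub_neg_eq_add, neg_add_eq_sub]

/-- The index in a multisequence given by a stack of choices, the latest first. -/
def pathIdx (idx : List ℕ) (n : ℕ) : ℕ := idx.foldl (fun acc m => Nat.pair m.unpair.1 acc) n

/-- A code of the amount by which a strict inequality is satisfied, after passing to the
complementary inequalities with the tolerances given by a stack of choices. -/
def margin (idx : List ℕ) (v : ℕ) : ℕ := idx.foldr (fun m acc => subc (epsc m.unpair.2) acc) v

theorem primrec_pathIdx : Primrec₂ pathIdx := by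
  refine Primrec.list_foldl (f := fun x : List ℕ × ℕ => x.1) (g := fun x => x.2)
    (h := fun _ y => Nat.pair y.2.unpair.1 y.1) Primrec.fst Primrec.snd ?_
  exact prim_pair (prim_left (Primrec.snd.comp Primrec.snd)) (Primrec.fst.comp Primrec.snd)

theorem primrec_margin : Primrec₂ margin := by
  refine Primrec.list_foldr (f := fun x : List ℕ × ℕ => x.1) (g := fun x => x.2)
    (h := fun _ y => subc (epsc y.1.unpair.2) y.2) Primrec.fst Primrec.snd ?_
  exact primrec_subc.comp (primrec_epsc.comp (prim_right (Primrec.fst.comp Primrec.snd)))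
    (Primrec.snd.comp Primrec.snd)

/-- A supremum of values g_i is positive exactly if, for some i and k, the inequality g_i < 1/(k+1)
fails. By reflection this inequality is again a positivity statement of lower rank. Each choice
therefore codes both an index i and a tolerance k, which `pathIdx` and `margin` accumulate. -/
theorem altSat_margin (b : ℕ → ℕ) (u d : ℕ) (idx : List ℕ) :
    altSat (fun idx => ∃ n, 0 < ratOf (margin idx (subc (b (pathIdx idx n)) u))) d idx ↔
      0 < altLimit d true fun n => ratOf (margin idx (subc (b (pathIdx idx n)) u)) := by
  induction d generalizing idx with
  | zero =>
    simp only [altSat, altLimit, lt_iSup_iff]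
    exact exists_congr fun n => by
      rw [← EReal.coe_zero, EReal.coe_lt_coe_iff, Rat.cast_pos]
  | succ d ih =>
    have h1 : ∀ m, altSat (fun idx => ∃ n, 0 < ratOf (margin idx (subc (b (pathIdx idx n)) u))) d
        (m :: idx) ↔ altLimit d false (fun n => ratOf (margin idx (subc (b (pathIdx idx
          (Nat.pair m.unpair.1 n))) u))) < (((1 / (m.unpair.2 + 1) : ℚ) : ℝ) : EReal) := by
      intro m
      have h2 := lt_altLimit_sub_iff d (fun n => ratOf (margin idx (subc (b (pathIdx idx
          (Nat.pair m.unpair.1 n))) u))) (1 / (m.unpair.2 + 1)) 0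
      rw [sub_zero, Rat.cast_zero, EReal.coe_zero] at h2
      rw [ih, ← h2]
      simp only [margin, pathIdx, List.foldr_cons, List.foldl_cons, ratOf_subc, ratOf_epsc]
    simp only [altSat, h1, not_lt, altLimit, lt_iSup_iff]
    constructor
    · rintro ⟨m, hm⟩
      refine ⟨m.unpair.1, lt_of_lt_of_le ?_ hm⟩
      have : (0 : ℝ) < ((1 / (m.unpair.2 + 1) : ℚ) : ℝ) := by
        rw [Rat.cast_pos]; positivity
      exact_mod_cast this
    · rintro ⟨i, hi⟩
      obtain ⟨z, hz, hz'⟩ := EReal.exists_rat_btwn_of_lt hi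
      have hz : (0 : ℝ) < z := by exact_mod_cast hz
      obtain ⟨k, hk⟩ := exists_nat_one_div_lt (Rat.cast_pos.1 hz)
      refine ⟨Nat.pair i k, ?_⟩
      simp only [Nat.unpair_pair]
      refine le_trans ?_ hz'.le
      exact_mod_cast (Rat.cast_le (K := ℝ)).2 hk.le

/-! ### Superlevel sets of simulated functions -/

section Semi

variable {D : ℕ} {X : Set (EuclideanSpace ℝ (Fin D))}

/-- `sim l k` tells whether the symbol number `k` of the output is known to be `1` once the input
is known to begin with the rational vectors listed by `l`. -/
structure Simulates (d : ℕ) (f : X → ℝ) (sim : List ℕ → ℕ → Bool) : Prop where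
  mono : ∀ l e k, sim l k = true → sim (l ++ e) k = true
  correct : ∀ (x : X) (a : ℕ → ℕ), (∀ n, x.1 ∈ cone D (pre a n)) → ∃ r, rhoLower d r (f x) ∧
    ∀ k, (∃ n, sim (pre a n) k = true) ↔ r k = true

/-- The table of the conditions for `f x > u_j`, where the string `u` encodes `(u_j)`. -/
def superTable (sim : List ℕ → ℕ → Bool) (u : Cantor) (j : ℕ) (idx l : List ℕ) : Bool :=
  (List.range l.length).any fun t =>
    (sim l (Nat.pair (pathIdx idx t.unpair.1) t.unpair.2.unpair.1) &&
      u (Nat.pair j t.unpair.2.unpair.2)) &&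
        ltc 0 (margin idx (subc t.unpair.2.unpair.1 t.unpair.2.unpair.2))

/-- The length of the list bounds the search, which keeps the table decidable and monotone; along a
whole name the bound disappears. -/
theorem superTable_iff {sim : List ℕ → ℕ → Bool} {v : ℕ → ℕ} {j : ℕ} {idx l : List ℕ} :
    superTable sim (charStr v) j idx l = true ↔ ∃ n k, Nat.pair n (Nat.pair k (v j)) < l.length ∧
      sim l (Nat.pair (pathIdx idx n) k) = true ∧ 0 < ratOf (margin idx (subc k (v j))) := by
  simp only [superTable, List.any_eq_true, List.mem_range, Bool.and_eq_true, ltc_iff, ratOf_zero]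
  constructor
  · rintro ⟨t, ht, ⟨h1, h2⟩, h3⟩
    rw [codes_charStr v] at h2
    refine ⟨t.unpair.1, t.unpair.2.unpair.1, ?_, h1, by rwa [← h2]⟩
    rwa [← h2, Nat.pair_unpair, Nat.pair_unpair]
  · rintro ⟨n, k, h0, h1, h2⟩
    refine ⟨_, h0, ?_⟩
    simp only [Nat.unpair_pair]
    exact ⟨⟨h1, (codes_charStr v _ _).2 rfl⟩, h2⟩

theorem reach_superTable {d : ℕ} {f : X → ℝ} {sim : List ℕ → ℕ → Bool} (h : Simulates d f sim)
    (v : ℕ → ℕ) (j : ℕ) (x : X) :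
    Reach x.1 (superTable sim (charStr v) j) d [] [] ↔ (ratOf (v j) : ℝ) < f x := by
  refine reach_iff ?_ ?_
  · intro idx l e
    rw [superTable_iff, superTable_iff]
    rintro ⟨n, k, h0, h1, h2⟩
    exact ⟨n, k, by rw [List.length_append]; omega, h.mono _ _ _ h1, h2⟩
  · intro a ha
    obtain ⟨r, ⟨b, hb, hlim⟩, hr⟩ := h.correct x a ha
    have h1 : (fun idx => ∃ n, superTable sim (charStr v) j idx (pre a n) = true) =
        fun idx => ∃ n, 0 < ratOf (margin idx (subc (b (pathIdx idx n)) (v j))) := by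
      funext idx
      simp only [superTable_iff, pre_length, eq_iff_iff]
      constructor
      · rintro ⟨N, n, k, -, hs, hk⟩
        have := (hb _ _).1 ((hr _).1 ⟨N, hs⟩)
        exact ⟨n, this ▸ hk⟩
      · rintro ⟨n, hn⟩
        obtain ⟨N, hN⟩ := (hr (Nat.pair (pathIdx idx n) (b (pathIdx idx n)))).2 ((hb _ _).2 rfl)
        -- The prefix must show the symbol (length at least N) and be strictly longer than the code
        -- M of the witness.
        let M := Nat.pair n (Nat.pair (b (pathIdx idx n)) (v j))
        obtain ⟨e, he⟩ := exists_pre_eq_append a (le_max_left N (M + 1))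
        exact ⟨max N (M + 1), n, b (pathIdx idx n), by omega, by rw [he]; exact h.mono _ _ _ hN, hn⟩
    rw [h1, altSat_margin]
    simp only [margin, pathIdx, List.foldr_nil, List.foldl_nil, ratOf_subc]
    rw [pos_altLimit_sub_iff, hlim, EReal.coe_lt_coe_iff]

/-- A name of the superlevel set. -/
def superName (D : ℕ) (pX : Cantor) (d : ℕ) (sim : List ℕ → ℕ → Bool) (u : Cantor) : Cantor :=
  iUnionName fun j => reachName D pX (superTable sim u j) d [] []

/-- Exceeding an infimum means exceeding one of its terms, so an upper name of y costs only a
countable union. -/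
theorem sigmaRep_superName {pX : Cantor} (hX : Covers X pX) {d : ℕ} {f : X → ℝ}
    {sim : List ℕ → ℕ → Bool} (h : Simulates d f sim) {u : Cantor} {y : ℝ} (hu : rhoUpper u y) :
    sigmaRep X (d + 1) (superName D pX d sim u) (f ⁻¹' Set.Ioi y) := by
  obtain ⟨v, hv, hy⟩ := hu
  have h1 := sigmaRep_iUnionName fun j =>
    sigmaRep_reachName hX (superTable sim (charStr v) j) d [] []
  have h2 : f ⁻¹' Set.Ioi y =
      ⋃ j, {x : X | Reach x.1 (superTable sim (charStr v) j) d [] []} := by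
    ext x
    simp only [Set.mem_preimage, Set.mem_Ioi, Set.mem_iUnion, Set.mem_ofPred_eq,
      reach_superTable h]
    rw [← EReal.coe_lt_coe_iff, ← hy]
    simp only [altLimit, iInf_lt_iff, EReal.coe_lt_coe_iff]
  rw [h2, superName, hv.eq_charStr]
  exact h1

theorem TC.superName {α : Type*} [Primcodable α] {pX : Cantor} (hpX : Computable pX) (d : ℕ)
    {S : Cantor → List ℕ × ℕ → Bool} (hS : TC S) {U : Cantor → ℕ → Bool} (hU : TC U)
    {T : Cantor → α → ℕ} (hT : TC T) :
    TC fun q a => HyperSemi.superName D pX d (fun l k => S q (l, k)) (U q) (T q a) := by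
  have h1 : TC fun q (x : ℕ × List ℕ × List ℕ) =>
      superTable (fun l k => S q (l, k)) (U q) x.1 x.2.1 x.2.2 := by
    have hx : TC fun _ (y : (ℕ × List ℕ × List ℕ) × ℕ) => y.1 := TC.id.fst
    have ht : TC fun _ (y : (ℕ × List ℕ × List ℕ) × ℕ) => y.2 := TC.id.snd
    refine TC.any (N := fun _ (x : ℕ × List ℕ × List ℕ) => x.2.2.length)
      (F := fun q (y : (ℕ × List ℕ × List ℕ) × ℕ) =>
      (S q (y.1.2.2, Nat.pair (pathIdx y.1.2.1 y.2.unpair.1) y.2.unpair.2.unpair.1) &&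
        U q (Nat.pair y.1.1 y.2.unpair.2.unpair.2)) &&
        ltc 0 (margin y.1.2.1 (subc y.2.unpair.2.unpair.1 y.2.unpair.2.unpair.2)))
      (TC.id.snd.snd.app Computable.list_length) ?_
    exact ((hS.comp (hx.snd.snd.pair ((hx.snd.fst.app₂ primrec_pathIdx.to_comp
      ht.left).natPair ht.right.left))).and (hU.comp (hx.fst.natPair ht.right.right))).and
      ((TC.const 0).app₂ primrec_ltc.to_comp (hx.snd.fst.app₂ primrec_margin.to_comp
        (ht.right.left.app₂ primrec_subc.to_comp ht.right.right)))
  have h2 := TC.reachName (D := D) hpX h1 d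
  have h3 : TC fun _ (x : (α × ℕ) × ℕ) => ((x.1.2, ([] : List ℕ), ([] : List ℕ)), x.2) :=
    (TC.id.fst.snd.pair (TC.const _)).pair TC.id.snd
  exact TC.iUnionName (h2.comp h3) hT

end Semi

/-! ### Pairs of strings -/

/-- The first component of a pair of strings. -/
def leftStr (z : Cantor) : Cantor := fun n => z (2 * n)

/-- The second component of a pair of strings. -/
def rightStr (z : Cantor) : Cantor := fun n => z (2 * n + 1)

theorem leftStr_pairStr (p q : Cantor) : leftStr (pairStr p q) = p := by
  funext n
  simp [leftStr, pairStr]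

theorem rightStr_pairStr (p q : Cantor) : rightStr (pairStr p q) = q := by
  funext n
  have h1 : (2 * n + 1) % 2 = 1 := by omega
  have h2 : (2 * n + 1) / 2 = n := by omega
  simp [rightStr, pairStr, h1, h2]

section TC

variable {α : Type*} [Primcodable α]

theorem TC.leftStr {F : Cantor → α → ℕ} (hF : TC F) :
    TC fun q a => HyperSemi.leftStr q (F q a) :=
  TC.query.comp (hF.app Primrec.nat_double.to_comp)

theorem TC.rightStr {F : Cantor → α → ℕ} (hF : TC F) :
    TC fun q a => HyperSemi.rightStr q (F q a) :=
  TC.query.comp (hF.app Primrec.nat_double_succ.to_comp)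

theorem TC.pairStr {P Q : Cantor → α × ℕ → Bool} (hP : TC P) (hQ : TC Q) {T : Cantor → α → ℕ}
    (hT : TC T) :
    TC fun q a => HyperSemi.pairStr (fun n => P q (a, n)) (fun n => Q q (a, n)) (T q a) := by
  have h2 : TC fun q a => T q a / 2 :=
    hT.app₂ Primrec.nat_div.to_comp (TC.const 2)
  have h : TC fun q a => if decide (T q a % 2 = 0) = true then P q (a, T q a / 2)
      else Q q (a, T q a / 2) :=
    TC.ite (TC.decideEq (hT.app₂ Primrec.nat_mod.to_comp (TC.const 2)) (TC.const 0))
      (hP.comp (TC.id.pair h2)) (hQ.comp (TC.id.pair h2))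
  simp only [decide_eq_true_eq] at h
  exact h

end TC

theorem pairStr_congr {p p' q q' : Cantor} {N : ℕ} (hp : ∀ i < N, p i = p' i)
    (hq : ∀ i < N, q i = q' i) : ∀ i < N, pairStr p q i = pairStr p' q' i := by
  intro i hi
  simp only [pairStr]
  rw [hp _ (by omega), hq _ (by omega)]

/-! ### Simulation of machines -/

/-- Phase t inspects a prefix of length at most t. -/
theorem machineStep_congr {c : Nat.Partrec.Code} {q q' : Cantor} {k t : ℕ}
    (h : ∀ i < t, q i = q' i) : machineStep c q k t = machineStep c q' k t := by
  have : pre q t.unpair.1 = pre q' t.unpair.1 := List.map_congr_left fun i hi =>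
    h i ((List.mem_range.1 hi).trans_le (Nat.unpair_left_le t))
  rw [machineStep, machineStep, this]

/-- The first `N` steps of the computation show that the output symbol number `k` is `1`. -/
def runsToOne (c : Nat.Partrec.Code) (q : Cantor) (k N : ℕ) : Bool :=
  decide (firstBelow (machineStep c q k) N = some 1)

theorem runsToOne_mono {c : Nat.Partrec.Code} {q q' : Cantor} {k N M : ℕ} (hNM : N ≤ M)
    (h : ∀ i < N, q i = q' i) (hr : runsToOne c q k N = true) : runsToOne c q' k M = true := by
  rw [runsToOne, decide_eq_true_eq, firstBelow_eq_some] at hr ⊢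
  obtain ⟨t, ht, h1, h2⟩ := hr
  refine ⟨t, by omega, ?_, fun s hs => ?_⟩
  · rw [← h1]
    exact machineStep_congr fun i hi => (h i (by omega)).symm
  · rw [← h2 s hs]
    exact machineStep_congr fun i hi => (h i (by omega)).symm

/-- Only symbols 1 need to be observed, since a graph is determined by its elements. -/
theorem exists_runsToOne_iff {c : Nat.Partrec.Code} {q r : Cantor} (h : Outputs c q r) (k : ℕ) :
    (∃ N, runsToOne c q k N = true) ↔ r k = true := by
  constructor
  · rintro ⟨N, hN⟩
    rw [runsToOne, decide_eq_true_eq, firstBelow_eq_some] at hN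
    obtain ⟨t, -, ht⟩ := hN
    have := Part.mem_unique (h k) (mem_machineSymbol.2 ⟨t, ht⟩)
    cases hr : r k
    · simp [hr] at this
    · rfl
  · intro hr
    have := h k
    rw [hr] at this
    obtain ⟨t, ht⟩ := mem_machineSymbol.1 this
    refine ⟨t + 1, ?_⟩
    rw [runsToOne, decide_eq_true_eq, firstBelow_eq_some]
    exact ⟨t, by omega, ht⟩

/-- The finite list `l`, continued by zeros. -/
def padded (l : List ℕ) : ℕ → ℕ := fun i => l.getD i 0

/-- The symbol at position i concerns an entry with index at most i. Hence a computation of N steps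
does not notice how a list of length N is continued. -/
theorem charStr_congr {a b : ℕ → ℕ} {N : ℕ} (h : ∀ i < N, a i = b i) :
    ∀ i < N, charStr a i = charStr b i := by
  intro i hi
  simp only [charStr]
  rw [h _ ((Nat.unpair_left_le i).trans_lt hi)]

theorem padded_append (l e : List ℕ) : ∀ i < l.length, padded l i = padded (l ++ e) i :=
  fun _ hi => (List.getD_append _ _ _ _ hi).symm

theorem padded_pre (a : ℕ → ℕ) (N : ℕ) : ∀ i < N, padded (pre a N) i = a i := by
  intro i hi
  rw [padded, List.getD_eq_getElem _ _ (by rwa [pre_length])]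
  simp [pre]

/-- The number `n` and the string `p` are read from the string `s = 0ⁿ 1 p`, and the machine
number `n` is run on `p` and the part of a name listed by `l`. -/
def nameSim (s : Cantor) (l : List ℕ) (k : ℕ) : Bool :=
  (List.range l.length).any fun n => (s n && (List.range n).all fun i => !s i) &&
    runsToOne (Denumerable.ofNat Nat.Partrec.Code n)
      (pairStr (fun i => s (n + 1 + i)) (charStr (padded l))) k l.length

theorem nameSim_iff {n : ℕ} {p : Cantor} {l : List ℕ} {k : ℕ} :
    nameSim (tagged n p) l k = true ↔ n < l.length ∧
      runsToOne (Denumerable.ofNat Nat.Partrec.Code n) (pairStr p (charStr (padded l))) k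
        l.length = true := by
  have hp : (fun i => tagged n p (n + 1 + i)) = p := by
    funext i
    have h1 : ¬ n + 1 + i < n := by omega
    have h2 : ¬ n + 1 + i = n := by omega
    have h3 : n + 1 + i - n - 1 = i := by omega
    simp [tagged, h1, h2, h3]
  simp only [nameSim, List.any_eq_true, List.mem_range, Bool.and_eq_true, List.all_eq_true]
  constructor
  · rintro ⟨m, hm, ⟨h1, h2⟩, h3⟩
    -- The first symbol 1 of the string determines the machine number.
    have hmn : m = n := by
      rcases lt_trichotomy m n with h | h | h
      · simp [tagged, h] at h1
      · exact h
      · have := h2 n h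
        simp [tagged] at this
    subst hmn
    rw [hp] at h3
    exact ⟨hm, h3⟩
  · rintro ⟨hn, h⟩
    refine ⟨n, hn, ⟨by simp [tagged], fun i hi => by simp [tagged, hi]⟩, ?_⟩
    rwa [hp]

theorem nameSim_append {s : Cantor} {l e : List ℕ} {k : ℕ} (h : nameSim s l k = true) :
    nameSim s (l ++ e) k = true := by
  simp only [nameSim, List.any_eq_true, List.mem_range, Bool.and_eq_true] at h ⊢
  obtain ⟨m, hm, h1, h2⟩ := h
  refine ⟨m, by rw [List.length_append]; omega, h1, ?_⟩
  exact runsToOne_mono (by rw [List.length_append]; omega)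
    (pairStr_congr (fun _ _ => rfl) (charStr_congr (padded_append l e))) h2

theorem TC.nameSim {S : Cantor → ℕ → Bool} (hS : TC S) :
    TC fun q (x : List ℕ × ℕ) => HyperSemi.nameSim (S q) x.1 x.2 := by
  have hlen : TC fun _ (x : List ℕ × ℕ) => x.1.length := TC.id.fst.app Computable.list_length
  have hall : TC fun q (x : (List ℕ × ℕ) × ℕ) => (List.range x.2).all fun i => !S q i :=
    TC.all TC.id.snd (F := fun q (y : ((List ℕ × ℕ) × ℕ) × ℕ) => !S q y.2)
      (hS.comp TC.id.snd).not
  have hstr : TC fun q (y : (((List ℕ × ℕ) × ℕ) × ℕ) × ℕ) =>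
      HyperSemi.pairStr (fun i => S q (y.1.1.2 + 1 + i))
        (HyperSemi.charStr (padded y.1.1.1.1)) y.2 := by
    refine TC.pairStr (P := fun q (z : ((((List ℕ × ℕ) × ℕ) × ℕ) × ℕ) × ℕ) =>
      S q (z.1.1.1.2 + 1 + z.2)) (Q := fun q z => HyperSemi.charStr (padded z.1.1.1.1.1) z.2)
      ?_ ?_ TC.id.snd
    · exact hS.comp (TC.app₂ Primrec.nat_add.to_comp
        (TC.id.fst.fst.fst.snd.app Computable.succ) TC.id.snd)
    · refine TC.charStr (F := fun _ (w : (((((List ℕ × ℕ) × ℕ) × ℕ) × ℕ) × ℕ) × ℕ) =>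
        padded w.1.1.1.1.1.1 w.2) ?_ TC.id.snd
      exact TC.app₂ (Primrec.list_getD 0).to_comp TC.id.fst.fst.fst.fst.fst.fst TC.id.snd
  have hstep : TC fun q (y : ((List ℕ × ℕ) × ℕ) × ℕ) =>
      HyperSemi.machineStep (Denumerable.ofNat Nat.Partrec.Code y.1.2)
        (HyperSemi.pairStr (fun i => S q (y.1.2 + 1 + i))
          (HyperSemi.charStr (padded y.1.1.1))) y.1.1.2 y.2 :=
    TC.machineStep (TC.id.fst.snd.app (Computable.ofNat Nat.Partrec.Code)) hstr
      TC.id.fst.fst.snd TC.id.snd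
  have hrun : TC fun q (x : (List ℕ × ℕ) × ℕ) =>
      runsToOne (Denumerable.ofNat Nat.Partrec.Code x.2)
        (HyperSemi.pairStr (fun i => S q (x.2 + 1 + i)) (HyperSemi.charStr (padded x.1.1)))
        x.1.2 x.1.1.length :=
    TC.decideEq (TC.firstBelow (TC.id.fst.fst.app Computable.list_length) hstep)
      (TC.const (some 1))
  exact TC.any (F := fun q (x : (List ℕ × ℕ) × ℕ) =>
    (S q x.2 && (List.range x.2).all fun i => !S q i) &&
      runsToOne (Denumerable.ofNat Nat.Partrec.Code x.2)
        (HyperSemi.pairStr (fun i => S q (x.2 + 1 + i)) (HyperSemi.charStr (padded x.1.1)))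
        x.1.2 x.1.1.length) hlen (((hS.comp TC.id.snd).and hall).and hrun)

section Semi

variable {D : ℕ} {X : Set (EuclideanSpace ℝ (Fin D))}

/-- The Euclidean distance bounds every coordinate. Only names with strict Euclidean estimates arise
in this way, and these suffice. -/
theorem rho_charStr {x : X} {a : ℕ → ℕ} (h : ∀ n, x.1 ∈ cone D (pre a n)) :
    rho X (charStr a) x := by
  refine ⟨a, codes_charStr a, fun m i => ?_⟩
  have h1 := h (m + 1) m (by rw [pre_length]; omega)
  have h2 : (pre a (m + 1)).getD m 0 = a m := padded_pre a (m + 1) m (by omega)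
  rw [h2, dist_eq_norm] at h1
  exact (PiLp.norm_apply_le (x.1 - cen D (a m)) i).trans h1.le

theorem simulates_nameSim {d : ℕ} {f : X → ℝ} {s : Cantor}
    (h : realizerRep (rho X) (rhoLower d) s f) : Simulates d f (nameSim s) := by
  refine ⟨fun _ _ _ => nameSim_append, fun x a ha => ?_⟩
  obtain ⟨r, ⟨n, p, rfl, hr⟩, hr'⟩ := h _ _ (rho_charStr ha)
  refine ⟨r, hr', fun k => ?_⟩
  rw [← exists_runsToOne_iff hr k]
  constructor
  · rintro ⟨N, hN⟩
    rw [nameSim_iff, pre_length] at hN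
    exact ⟨N, runsToOne_mono le_rfl
      (pairStr_congr (fun _ _ => rfl) (charStr_congr (padded_pre a N))) hN.2⟩
  · rintro ⟨N, hN⟩
    refine ⟨max N (n + 1), ?_⟩
    rw [nameSim_iff, pre_length]
    refine ⟨by omega, runsToOne_mono (le_max_left _ _) (pairStr_congr (fun _ _ => rfl)
      (charStr_congr fun i hi => (padded_pre a _ i (by omega)).symm)) hN⟩

theorem exists_cylinder_subset {U : Set Cantor} (hU : IsOpen U) {z : Cantor} (hz : z ∈ U) :
    ∃ N, ∀ w : Cantor, (∀ i < N, w i = z i) → w ∈ U := by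
  obtain ⟨_, ⟨y, n, rfl⟩, hzy, hsub⟩ :=
    (PiNat.isTopologicalBasis_cylinders fun _ : ℕ => Bool).exists_subset_of_mem_open hz hU
  refine ⟨n, fun w hw => hsub fun i hi => ?_⟩
  rw [hw i hi]
  exact hzy i hi

-- Without effectivity, the table may ask whether all names extending the list yield the symbol 1;
-- continuity on the set of names makes some finite prefix sufficient. Lists that no name extends
-- pass vacuously, which is harmless because only prefixes of names are tested.
open Classical in
theorem exists_simulates {d : ℕ} {f : X → ℝ} (h : IsContinuousFun (rho X) (rhoLower d) f) :
    ∃ sim, Simulates d f sim := by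
  obtain ⟨F, hF, hf⟩ := h
  refine ⟨fun l k => decide (∀ a : ℕ → ℕ, pre a l.length = l → (∃ x, rho X (charStr a) x) →
    F (charStr a) k = true), fun l e k hl => ?_, fun x a ha => ?_⟩
  · rw [decide_eq_true_eq] at hl ⊢
    intro a hal
    refine hl a ?_
    rw [List.length_append, pre_add] at hal
    exact (List.append_inj hal (pre_length _ _)).1
  · have hx := rho_charStr ha
    refine ⟨_, hf _ _ hx, fun k => ?_⟩
    simp only [decide_eq_true_eq, pre_length]
    constructor
    · rintro ⟨N, hN⟩
      exact hN a rfl ⟨x, hx⟩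
    · intro hk
      have hopen : IsOpen {z : Cantor | z k = true} :=
        (isOpen_discrete ({true} : Set Bool)).preimage (f := fun z : Cantor => z k)
          (continuous_apply k)
      have hnhds := hF _ ⟨x, hx⟩ (hopen.mem_nhds hk)
      obtain ⟨U, hU, haU, hsub⟩ := mem_nhdsWithin.1 hnhds
      obtain ⟨N, hN⟩ := exists_cylinder_subset hU haU
      refine ⟨N, fun b hb hb' => hsub ⟨hN _ (charStr_congr fun i hi => ?_), hb'⟩⟩
      rw [← padded_pre b N i hi, hb, padded_pre a N i hi]

/-! ### Semimeasurability of continuous and of computable functions. -/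

theorem borelSigma_of_sigmaRep {d : ℕ} {p : Cantor} {S : Set X} (h : sigmaRep X d p S) :
    BorelSigma d S := by
  induction d generalizing p S with
  | zero => exact h
  | succ d ih =>
    cases d with
    | zero =>
      obtain ⟨a, -, ha⟩ := h
      have h1 : IsOpen (Subtype.val '' S : Set (EuclideanSpace ℝ (Fin D))) := by
        rw [ha]
        exact isOpen_iUnion fun m => Metric.isOpen_ball
      have h2 := h1.preimage (continuous_subtype_val (p := (· ∈ X)))
      rwa [Set.preimage_image_eq _ Subtype.val_injective] at h2
    | succ d =>
      obtain ⟨T, hT, rfl⟩ := h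
      exact ⟨T, fun m => ih (hT m), rfl⟩

theorem exists_rhoUpper (y : ℝ) : ∃ u, rhoUpper u y := by
  obtain ⟨q₀, hq₀⟩ := exists_rat_gt y
  obtain ⟨n₀, rfl⟩ := ratOf_surjective q₀
  classical
  -- All rationals above y are listed; the others are replaced by one fixed upper bound.
  refine ⟨_, fun n => if y < (ratOf n : ℝ) then n else n₀, codes_charStr _, ?_⟩
  refine le_antisymm ?_ (le_iInf fun n => ?_)
  · refine le_of_forall_gt fun z hz => ?_
    obtain ⟨q, hq, hq'⟩ := EReal.exists_rat_btwn_of_lt hz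
    obtain ⟨n, rfl⟩ := ratOf_surjective q
    refine (iInf_le _ n).trans_lt ?_
    simp only
    rw [if_pos (by exact_mod_cast hq)]
    exact hq'
  · simp only [EReal.coe_le_coe_iff]
    split_ifs with h
    · exact h.le
    · exact hq₀.le

theorem lowerSemimeasurable_of_simulates {pX : Cantor} (hX : Covers X pX) {d : ℕ} {f : X → ℝ}
    {sim : List ℕ → ℕ → Bool} (h : Simulates d f sim) : LowerSemimeasurable (d + 1) f := by
  intro y
  obtain ⟨u, hu⟩ := exists_rhoUpper y
  exact borelSigma_of_sigmaRep (sigmaRep_superName hX h hu)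

theorem isComputableFun_superlevel {pX : Cantor} (hpX : Computable pX) (hX : Covers X pX)
    (d : ℕ) : IsComputableFun (Rep.prod (realizerRep (rho X) (rhoLower d)) rhoUpper)
      (sigmaRep X (d + 1)) fun fy : (X → ℝ) × ℝ => fy.1 ⁻¹' Set.Ioi fy.2 := by
  have h : TC fun z (t : ℕ) => superName D pX d (nameSim (leftStr z)) (rightStr z) t :=
    TC.superName hpX d (TC.nameSim (TC.leftStr TC.id)) (TC.rightStr TC.id) TC.id
  obtain ⟨c, hc⟩ := exists_machine h
  refine ⟨c, ?_⟩
  rintro _ ⟨f, y⟩ ⟨s, u, rfl, hs, hu⟩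
  refine ⟨_, hc _, ?_⟩
  rw [leftStr_pairStr, rightStr_pairStr]
  exact sigmaRep_superName hX (simulates_nameSim hs) hu

/-- The parameter string is not needed, so a machine that reads only the right component is named
with a zero parameter. This name is computable, which reduces the effective statement to the uniform
one. -/
theorem exists_realizer {A B : Type*} {δ : Rep A} {γ : Rep B} {f : A → B}
    (h : IsComputableFun δ γ f) : ∃ n, realizerRep δ γ (tagged n fun _ => false) f := by
  obtain ⟨c, hc⟩ := h
  obtain ⟨c', hc'⟩ := exists_machine_comp (F := rightStr) (TC.rightStr TC.id) c
  refine ⟨Encodable.encode c', fun p a hp => ?_⟩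
  obtain ⟨r, hr, hr'⟩ := hc p a hp
  refine ⟨r, ⟨_, _, rfl, ?_⟩, hr'⟩
  rw [Denumerable.ofNat_encode]
  exact hc' _ _ (by rwa [rightStr_pairStr])

theorem effectivelyLowerSemimeasurable {pX : Cantor} (hpX : Computable pX) (hX : Covers X pX)
    {d : ℕ} {f : X → ℝ} (h : IsComputableFun (rho X) (rhoLower d) f) :
    EffectivelyLowerSemimeasurable (d + 1) f := by
  obtain ⟨n, hn⟩ := exists_realizer h
  refine ⟨lowerSemimeasurable_of_simulates hX (simulates_nameSim hn), ?_⟩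
  obtain ⟨c, hc⟩ := isComputableFun_superlevel hpX hX d
  have hs : TC fun (u : Cantor) (t : ℕ) => pairStr (tagged n fun _ => false) u t := by
    refine TC.pairStr (P := fun _ (x : ℕ × ℕ) => tagged n (fun _ => false) x.2)
      (Q := fun u x => u x.2) ?_ (TC.query.comp TC.id.snd) TC.id
    have h1 : TC fun _ (x : ℕ × ℕ) => decide (x.2 = n) := TC.decideEq TC.id.snd (TC.const n)
    convert h1 using 3 with _ x
    unfold tagged
    split_ifs with h2 h3
    · simp; omega
    · simp [h3]
    · simp [h3]
  obtain ⟨c', hc'⟩ := exists_machine_comp hs c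
  refine ⟨c', fun u y hu => ?_⟩
  obtain ⟨r, hr, hr'⟩ := hc _ (f, y) ⟨_, u, rfl, hn, hu⟩
  exact ⟨r, hc' _ _ hr, hr'⟩

end Semi

/-! ### Alternating limits of two-valued multisequences -/

/-- The multisequence of the truth values at the leaves of an alternating formula. -/
def leaf (B : List ℕ → ℕ → Bool) : ℕ → List ℕ → ℕ → Bool
  | 0, idx, t => B idx t
  | d + 1, idx, s => !leaf B d (s.unpair.1 :: idx) s.unpair.2

theorem TC.leaf {α : Type*} [Primcodable α] {B : Cantor → α × List ℕ × ℕ → Bool} (hB : TC B)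
    (d : ℕ) {I : Cantor → α → List ℕ} {S : Cantor → α → ℕ} (hI : TC I) (hS : TC S) :
    TC fun q a => HyperSemi.leaf (fun idx t => B q (a, idx, t)) d (I q a) (S q a) := by
  induction d generalizing I S with
  | zero => exact hB.comp (TC.id.pair (hI.pair hS))
  | succ d ih => exact (ih (hS.left.app₂ Computable.list_cons hI) hS.right).not

-- Suprema of the two values act as existential quantifiers; the negation between levels swaps the
-- values and turns the next operator into an infimum. The two claims feed each other in the
-- induction.
open Classical in
theorem altLimit_leaf (B : List ℕ → ℕ → Bool) (d : ℕ) (idx : List ℕ) {a b : ℚ} (hab : b ≤ a) :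
    altLimit d true (fun s => if leaf B d idx s = true then a else b) =
        (if altSat (fun idx => ∃ t, B idx t = true) d idx then ((a : ℝ) : EReal) else (b : ℝ)) ∧
      altLimit d false (fun s => if leaf B d idx s = true then b else a) =
        (if altSat (fun idx => ∃ t, B idx t = true) d idx then ((b : ℝ) : EReal) else (a : ℝ)) := by
  have hab' : ((b : ℝ) : EReal) ≤ (a : ℝ) := by exact_mod_cast (Rat.cast_le (K := ℝ)).2 hab
  have sup : ∀ A : ℕ → Prop, (⨆ m, if A m then ((a : ℝ) : EReal) else (b : ℝ)) =
      if ∃ m, A m then ((a : ℝ) : EReal) else (b : ℝ) := by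
    intro A
    split_ifs with h
    · obtain ⟨m, hm⟩ := h
      refine le_antisymm (iSup_le fun n => ?_) (le_iSup_of_le m (by rw [if_pos hm]))
      split_ifs
      exacts [le_rfl, hab']
    · push Not at h
      simp [h]
  have inf : ∀ A : ℕ → Prop, (⨅ m, if A m then ((b : ℝ) : EReal) else (a : ℝ)) =
      if ∃ m, A m then ((b : ℝ) : EReal) else (a : ℝ) := by
    intro A
    split_ifs with h
    · obtain ⟨m, hm⟩ := h
      refine le_antisymm (iInf_le_of_le m (by rw [if_pos hm])) (le_iInf fun n => ?_)
      split_ifs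
      exacts [le_rfl, hab']
    · push Not at h
      simp [h]
  induction d generalizing idx with
  | zero =>
    constructor
    · refine Eq.trans ?_ (sup fun n => B idx n = true)
      exact iSup_congr fun n => by by_cases h : B idx n = true <;> simp [leaf, h]
    · refine Eq.trans ?_ (inf fun n => B idx n = true)
      exact iInf_congr fun n => by by_cases h : B idx n = true <;> simp [leaf, h]
  | succ d ih =>
    have flip : ∀ (c : Bool) (u v : ℚ), (if (!c) = true then u else v) = if c = true then v else u :=
      fun c u v => by cases c <;> rfl
    simp only [altLimit, leaf, flip, Nat.unpair_pair, (ih _).1, (ih _).2]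
    constructor
    · refine Eq.trans ?_ (sup fun m => ¬ altSat (fun idx => ∃ t, B idx t = true) d (m :: idx))
      exact iSup_congr fun n => by split_ifs <;> rfl
    · refine Eq.trans ?_ (inf fun m => ¬ altSat (fun idx => ∃ t, B idx t = true) d (m :: idx))
      exact iInf_congr fun n => by split_ifs <;> rfl

/-- Merges an additional leading index into the first index of a multisequence. -/
def merge {β : Type*} (G : ℕ → ℕ → β) : ℕ → ℕ → β
  | 0, s => G s.unpair.1 s.unpair.2
  | _ + 1, s => G s.unpair.1.unpair.1 (Nat.pair s.unpair.1.unpair.2 s.unpair.2)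

/-- A leading operator of the same kind as the first one is absorbed by pairing the two indices, so
the number of alternations is unchanged. -/
theorem altLimit_merge (G : ℕ → ℕ → ℕ) (d : ℕ) :
    altLimit d true (fun s => ratOf (merge G d s)) =
        ⨆ j, altLimit d true (fun s => ratOf (G j s)) ∧
      altLimit d false (fun s => ratOf (merge G d s)) =
        ⨅ j, altLimit d false (fun s => ratOf (G j s)) := by
  cases d with
  | zero =>
    exact ⟨iSup_unpair fun i j => ((ratOf (G i j) : ℝ) : EReal),
      iInf_unpair fun i j => ((ratOf (G i j) : ℝ) : EReal)⟩
  | succ d =>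
    simp only [altLimit, merge, Nat.unpair_pair]
    exact ⟨iSup_unpair fun i j => altLimit d false fun n => ratOf (G i (Nat.pair j n)),
      iInf_unpair fun i j => altLimit d true fun n => ratOf (G i (Nat.pair j n))⟩

theorem TC.merge {α β : Type*} [Primcodable α] [Primcodable β] {G : Cantor → α × ℕ × ℕ → β}
    (hG : TC G) (d : ℕ) {S : Cantor → α → ℕ} (hS : TC S) :
    TC fun q a => HyperSemi.merge (fun j s => G q (a, j, s)) d (S q a) := by
  cases d with
  | zero => exact hG.comp (TC.id.pair (hS.left.pair hS.right))
  | succ d => exact hG.comp (TC.id.pair (hS.left.left.pair (hS.left.right.natPair hS.right)))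

/-! ### The membership relation -/

/-- The index in a multisequence of symbols given by a stack of choices, the latest first. -/
def nestIdx (idx : List ℕ) (s : ℕ) : ℕ := idx.foldl (fun acc m => Nat.pair m acc) s

theorem primrec_nestIdx : Primrec₂ nestIdx := by
  refine Primrec.list_foldl (f := fun x : List ℕ × ℕ => x.1) (g := fun x => x.2)
    (h := fun _ y => Nat.pair y.2 y.1) Primrec.fst Primrec.snd ?_
  exact prim_pair (Primrec.snd.comp Primrec.snd) (Primrec.fst.comp Primrec.snd)

/-- The approximation number `j` of the point named by `q` shows that the point is in a ball
listed by a component of `p`. -/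
def memTest (D : ℕ) (p q : Cantor) (idx : List ℕ) (t : ℕ) : Bool :=
  (p (nestIdx idx t.unpair.1) && q t.unpair.2) &&
    near D t.unpair.2.unpair.2 t.unpair.1.unpair.2.unpair.1
      (subc t.unpair.1.unpair.2.unpair.2 (mulc (natc D) (powc t.unpair.2.unpair.1)))

theorem TC.memTest {α : Type*} [Primcodable α] (D : ℕ) {P Q : Cantor → α × ℕ → Bool}
    (hP : TC P) (hQ : TC Q) {I : Cantor → α → List ℕ} {T : Cantor → α → ℕ} (hI : TC I)
    (hT : TC T) : TC fun q a =>
      HyperSemi.memTest D (fun n => P q (a, n)) (fun n => Q q (a, n)) (I q a) (T q a) := by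
  have h : Primrec fun t : ℕ => near D t.unpair.2.unpair.2 t.unpair.1.unpair.2.unpair.1
      (subc t.unpair.1.unpair.2.unpair.2 (mulc (natc D) (powc t.unpair.2.unpair.1))) := by
    have ht : Primrec fun t : ℕ => t := Primrec.id
    exact primrec_near D (prim_right (prim_right ht)) (prim_left (prim_right (prim_left ht)))
      (primrec_subc.comp (prim_right (prim_right (prim_left ht)))
        (primrec_mulc.comp (Primrec.const _) (primrec_powc.comp (prim_left (prim_right ht)))))
  exact ((hP.comp (TC.id.pair (hI.app₂ primrec_nestIdx.to_comp hT.left))).and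
    (hQ.comp (TC.id.pair hT.right))).and (hT.app h.to_comp)

section Mem

variable {D : ℕ} {X : Set (EuclideanSpace ℝ (Fin D))}

theorem dist_cen_le {x : EuclideanSpace ℝ (Fin D)} {n : ℕ} {δ : ℝ}
    (h : ∀ i, |x i - (ratVecOf D n i : ℝ)| ≤ δ) : dist x (cen D n) ≤ D * δ := by
  have h1 : dist x (cen D n) ≤ ∑ i, |x i - (ratVecOf D n i : ℝ)| := by
    rw [EuclideanSpace.dist_eq]
    refine Real.sqrt_le_iff.2 ⟨Finset.sum_nonneg fun _ _ => abs_nonneg _, ?_⟩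
    exact Finset.sum_sq_le_sq_sum_of_nonneg fun _ _ => abs_nonneg _
  refine h1.trans ((Finset.sum_le_sum fun i _ => h i).trans ?_)
  simp

theorem exists_mul_pow_lt (D : ℕ) {ε : ℝ} (hε : 0 < ε) : ∃ m : ℕ, D * (2 : ℝ)⁻¹ ^ m < ε := by
  have h : Filter.Tendsto (fun m : ℕ => (D : ℝ) * (2 : ℝ)⁻¹ ^ m) Filter.atTop (nhds (D * 0)) :=
    (tendsto_pow_atTop_nhds_zero_of_lt_one (by norm_num) (by norm_num)).const_mul _
  rw [mul_zero] at h
  exact (h.eventually_lt_const hε).exists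

/-- In the lowest class, x lies in a ball exactly if some approximation lies in it with the safety
margin D · 2^{-j}. Higher up, each complement contributes one negated existential quantifier. -/
theorem mem_iff_altSat {p q : Cantor} {x : X} (hq : rho X q x) (d : ℕ) (idx : List ℕ) {S : Set X}
    (hp : sigmaRep X (d + 1) (fun s => p (nestIdx idx s)) S) :
    x ∈ S ↔ altSat (fun idx => ∃ t, memTest D p q idx t = true) d idx := by
  induction d generalizing idx S with
  | zero =>
    obtain ⟨b, hb, hS⟩ := hp
    obtain ⟨a, ha, hx⟩ := hq
    have hdist := fun m => dist_cen_le (hx m)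
    have h1 : x ∈ S ↔ ∃ m, x.1 ∈ ratBall D (b m) := by
      rw [← Set.mem_iUnion, ← hS, Subtype.val_injective.mem_set_image]
    rw [h1]
    simp only [altSat, memTest, Bool.and_eq_true, near_iff, ratOf_subc, ratOf_mulc, ratOf_natc,
      ratOf_powc, mem_ratBall]
    push_cast
    constructor
    · rintro ⟨m, hm⟩
      -- The error D · 2^{-j} enters twice: as the margin in the test and as the distance of the
      -- approximation from x.
      obtain ⟨j, hj⟩ := exists_mul_pow_lt (2 * D) (sub_pos.2 hm)
      refine ⟨Nat.pair (Nat.pair m (b m)) (Nat.pair j (a j)), ?_⟩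
      simp only [Nat.unpair_pair]
      refine ⟨⟨(hb _ _).2 rfl, (ha _ _).2 rfl⟩, ?_⟩
      push_cast at hj
      linarith [hdist j, dist_triangle_left (cen D (a j)) (cen D (b m).unpair.1) x.1]
    · rintro ⟨t, ⟨h1, h2⟩, h3⟩
      have h1' := (hb t.unpair.1.unpair.1 t.unpair.1.unpair.2).1 (by
        rw [Nat.pair_unpair]; exact h1)
      have h2' := (ha t.unpair.2.unpair.1 t.unpair.2.unpair.2).1 (by
        rw [Nat.pair_unpair]; exact h2)
      refine ⟨t.unpair.1.unpair.1, ?_⟩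
      rw [← h1']
      have h4 := hdist t.unpair.2.unpair.1
      rw [← h2'] at h4
      linarith [dist_triangle x.1 (cen D t.unpair.2.unpair.2) (cen D t.unpair.1.unpair.2.unpair.1)]
  | succ d ih =>
    obtain ⟨T, hT, rfl⟩ := hp
    simp only [Set.mem_iUnion, Set.mem_compl_iff, altSat]
    exact exists_congr fun m => not_congr (ih (m :: idx) (hT m))

/-- A machine for the uniform characteristic function. -/
theorem isComputableFun_indicator (X : Set (EuclideanSpace ℝ (Fin D))) (d : ℕ) :
    IsComputableFun (Rep.prod (sigmaRep X (d + 1)) (rho X)) (rhoLower d)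
      fun Sx : Set X × X => Set.indicator Sx.1 (fun _ => (1 : ℝ)) Sx.2 := by
  have hB : TC fun z (x : ℕ × List ℕ × ℕ) =>
      memTest D (leftStr z) (rightStr z) x.2.1 x.2.2 :=
    TC.memTest D (TC.leftStr TC.id.snd) (TC.rightStr TC.id.snd) TC.id.snd.fst TC.id.snd.snd
  have h : TC fun z (t : ℕ) => charStr (fun s =>
      if leaf (memTest D (leftStr z) (rightStr z)) d [] s = true then natc 1 else 0) t := by
    refine TC.charStr (F := fun z x =>
      if leaf (memTest D (leftStr z) (rightStr z)) d [] x.2 = true then natc 1 else 0) ?_ TC.id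
    exact TC.ite ((TC.leaf hB d (TC.const []) TC.id).comp TC.id.snd) (TC.const _) (TC.const _)
  obtain ⟨c, hc⟩ := exists_machine h
  refine ⟨c, ?_⟩
  rintro _ ⟨S, x⟩ ⟨p, q, rfl, hp, hq⟩
  refine ⟨_, hc _, _, codes_charStr _, ?_⟩
  rw [leftStr_pairStr, rightStr_pairStr]
  have h1 := (altLimit_leaf (memTest D p q) d [] (a := 1) (b := 0) zero_le_one).1
  have h2 := mem_iff_altSat hq d [] (S := S) hp
  have h3 : (fun s => ratOf (if leaf (memTest D p q) d [] s = true then natc 1 else 0)) =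
      fun s => if leaf (memTest D p q) d [] s = true then 1 else 0 := by
    funext s
    split_ifs
    · simp [ratOf_natc]
    · exact ratOf_zero
  rw [h3, h1]
  simp only at hp ⊢
  by_cases hx : x ∈ S
  · rw [if_pos (h2.1 hx), Set.indicator_of_mem hx, Rat.cast_one]
  · rw [if_neg (mt h2.2 hx), Set.indicator_of_notMem hx, Rat.cast_zero]

/-! ### The apply operator. -/

theorem TC.component {α : Type*} [Primcodable α] {P : Cantor → ℕ → Bool} (hP : TC P)
    {M K : Cantor → α → ℕ} (hM : TC M) (hK : TC K) :
    TC fun q a => HyperSemi.component (P q) (M q a) (K q a) := hP.comp (hM.natPair hK)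

theorem TC.memTest_component {α : Type*} [Primcodable α] (D : ℕ) {N : Cantor → α → ℕ}
    {I : Cantor → α → List ℕ} {T : Cantor → α → ℕ} (hN : TC N) (hI : TC I) (hT : TC T) :
    TC fun z a => HyperSemi.memTest D (HyperSemi.component (HyperSemi.leftStr z) (N z a))
      (HyperSemi.rightStr z) (I z a) (T z a) :=
  TC.memTest D (P := fun z x => HyperSemi.component (HyperSemi.leftStr z) (N z x.1) x.2)
    (Q := fun z x => HyperSemi.rightStr z x.2)
    (TC.component (TC.leftStr TC.id) (hN.comp TC.id.fst) TC.id.snd) (TC.rightStr TC.id.snd) hI hT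

/-- A machine for the apply operator of lower semicontinuous functions. -/
theorem isComputableFun_apply_zero (X : Set (EuclideanSpace ℝ (Fin D))) :
    IsComputableFun (Rep.prod (semiRep X 0) (rho X)) (rhoLower 0)
      fun fx : {f : X → ℝ // LowerSemimeasurable 1 f} × X => fx.1.1 fx.2 := by
  let test : Cantor → ℕ → Bool := fun z i =>
    memTest D (component (leftStr z) i.unpair.1) (rightStr z) [] i.unpair.2
  have htest : TC test := TC.memTest_component D TC.id.left (TC.const []) TC.id.right
  -- Failed tests must still output a rational below f(x). The machine therefore waits for a first
  -- successful test and uses its rational as the default; this search ends because some rational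
  -- lies below f(x).
  have h : TC fun z (x : ℕ × ℕ) => if test z x.2 = true then
      some (charStr (fun s => if test z s = true then s.unpair.1 else x.2.unpair.1) x.1)
      else none := by
    refine TC.ite (htest.comp TC.id.snd) (TC.app Computable.option_some ?_) (TC.const none)
    exact TC.charStr (F := fun z (y : (ℕ × ℕ) × ℕ) =>
      if test z y.2 = true then y.2.unpair.1 else y.1.2.unpair.1)
      (TC.ite (htest.comp TC.id.snd) TC.id.snd.left TC.id.fst.snd.left) TC.id.fst
  obtain ⟨c, hc⟩ := exists_machine_of_search h
  refine ⟨c, ?_⟩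
  rintro _ ⟨⟨f, hf⟩, x⟩ ⟨p, q, rfl, hp, hq⟩
  have key : ∀ n, (ratOf n : ℝ) < f x ↔ ∃ t, test (pairStr p q) (Nat.pair n t) = true := by
    intro n
    have : (ratOf n : ℝ) < f x ↔ _ := mem_iff_altSat (p := component p n) hq 0 [] (hp n)
    simpa only [test, leftStr_pairStr, rightStr_pairStr, Nat.unpair_pair, altSat] using this
  have key' : ∀ i, test (pairStr p q) i = true → (ratOf i.unpair.1 : ℝ) < f x := fun i hi =>
    (key _).2 ⟨i.unpair.2, by rwa [Nat.pair_unpair]⟩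
  have hex : ∃ i, test (pairStr p q) i = true := by
    obtain ⟨y, hy⟩ := exists_rat_lt (f x)
    obtain ⟨n, rfl⟩ := ratOf_surjective y
    obtain ⟨t, ht⟩ := (key n).1 hy
    exact ⟨_, ht⟩
  refine ⟨_, hc _ _ fun k => ⟨Nat.find hex, ?_, fun m hm => ?_⟩, _, codes_charStr fun s =>
    if test (pairStr p q) s = true then s.unpair.1 else (Nat.find hex).unpair.1, ?_⟩
  · rw [if_pos (Nat.find_spec hex)]
  · rw [if_neg (Nat.find_min hex hm)]
  · refine le_antisymm (iSup_le fun s => ?_) (le_of_forall_lt fun z hz => ?_)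
    · rw [EReal.coe_le_coe_iff]
      refine le_of_lt ?_
      change (ratOf (if test (pairStr p q) s = true then s.unpair.1 else
        (Nat.find hex).unpair.1) : ℝ) < f x
      split_ifs with hs
      · exact key' s hs
      · exact key' _ (Nat.find_spec hex)
    · obtain ⟨y, hy, hy'⟩ := EReal.exists_rat_btwn_of_lt hz
      obtain ⟨n, rfl⟩ := ratOf_surjective y
      obtain ⟨t, ht⟩ := (key n).1 (by exact_mod_cast hy')
      refine hy.trans_le (le_iSup_of_le (Nat.pair n t) ?_)
      simp only
      rw [if_pos ht, Nat.unpair_pair]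

/-- A machine for the apply operator of lower semimeasurable functions of higher classes. -/
theorem isComputableFun_apply_succ (X : Set (EuclideanSpace ℝ (Fin D))) (e : ℕ) :
    IsComputableFun (Rep.prod (semiRep X (e + 1)) (rho X)) (rhoLower (e + 1))
      fun fx : {f : X → ℝ // LowerSemimeasurable (e + 1 + 1) f} × X => fx.1.1 fx.2 := by
  let B : Cantor → ℕ → List ℕ → ℕ → Bool := fun z n =>
    memTest D (component (leftStr z) n) (rightStr z)
  -- The penalty j replaces the forbidden leaf value -∞: the infimum over j sends a failed witness m
  -- to -∞ and leaves a valid one at the rational coded by n.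
  let H : Cantor → ℕ → ℕ → ℕ → ℕ → ℕ := fun z n m j s =>
    if leaf (B z n) e [m] s = true then subc n (natc j) else n
  -- The infimum over j joins the infimum following the witness m; the supremum over n later joins
  -- the supremum over m.
  let G : Cantor → ℕ → ℕ → ℕ := fun z n s => merge (H z n s.unpair.1) e s.unpair.2
  have hH : TC fun z (x : (ℕ × ℕ) × ℕ × ℕ) => H z x.1.1 x.1.2 x.2.1 x.2.2 := by
    have hB : TC fun z (y : ((ℕ × ℕ) × ℕ × ℕ) × List ℕ × ℕ) => B z y.1.1.1 y.2.1 y.2.2 :=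
      TC.memTest_component D TC.id.fst.fst.fst TC.id.snd.fst TC.id.snd.snd
    exact TC.ite (TC.leaf hB e (TC.id.fst.snd.app₂ Computable.list_cons (TC.const []))
      TC.id.snd.snd) (TC.id.fst.fst.app₂ primrec_subc.to_comp
        (TC.id.snd.fst.app primrec_natc.to_comp)) TC.id.fst.fst
  have hG : TC fun z (x : ℕ × ℕ) => G z x.1 x.2 := by
    have h1 : TC fun z (x : (ℕ × ℕ) × ℕ × ℕ) => H z x.1.1 x.1.2.unpair.1 x.2.1 x.2.2 :=
      hH.comp ((TC.id.fst.fst.pair TC.id.fst.snd.left).pair TC.id.snd)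
    exact TC.merge h1 e TC.id.snd.right
  have hM : TC fun z (s : ℕ) => merge (G z) (e + 1) s :=
    TC.merge (hG.comp TC.id.snd) (e + 1) TC.id
  obtain ⟨c, hc⟩ := exists_machine (TC.charStr (F := fun z (x : ℕ × ℕ) => merge (G z) (e + 1) x.2)
    (hM.comp TC.id.snd) (T := fun _ t => t) TC.id)
  refine ⟨c, ?_⟩
  rintro _ ⟨⟨f, hf⟩, x⟩ ⟨p, q, rfl, hp, hq⟩
  refine ⟨_, hc _, _, codes_charStr _, ?_⟩
  set z := pairStr p q with hz
  have key : ∀ n, (ratOf n : ℝ) < f x ↔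
      ∃ m, ¬ altSat (fun idx => ∃ t, B z n idx t = true) e [m] := by
    intro n
    have : (ratOf n : ℝ) < f x ↔ _ := mem_iff_altSat (p := component p n) hq (e + 1) [] (hp n)
    simpa only [B, hz, leftStr_pairStr, rightStr_pairStr, altSat] using this
  classical
  have hlim : ∀ n m j, altLimit e false (fun s => ratOf (H z n m j s)) =
      if altSat (fun idx => ∃ t, B z n idx t = true) e [m] then (((ratOf n - j : ℚ) : ℝ) : EReal)
      else ((ratOf n : ℝ) : EReal) := by
    intro n m j
    have h1 : (fun s => ratOf (H z n m j s)) =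
        fun s => if leaf (B z n) e [m] s = true then ratOf n - j else ratOf n := by
      funext s
      simp only [H]
      split_ifs
      · rw [ratOf_subc, ratOf_natc]
      · rfl
    rw [h1, (altLimit_leaf (B z n) e [m] (sub_le_self _ (Nat.cast_nonneg j))).2]
  have htotal : altLimit (e + 1) true (fun s => ratOf (merge (G z) (e + 1) s)) =
      ⨆ n, ⨆ m, ⨅ j : ℕ, if altSat (fun idx => ∃ t, B z n idx t = true) e [m]
        then (((ratOf n - j : ℚ) : ℝ) : EReal) else ((ratOf n : ℝ) : EReal) := by
    rw [(altLimit_merge (G z) (e + 1)).1]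
    refine iSup_congr fun n => ?_
    simp only [altLimit, G, Nat.unpair_pair, (altLimit_merge _ e).2, hlim]
  refine htotal.trans (le_antisymm (iSup_le fun n => iSup_le fun m => ?_)
    (le_of_forall_lt fun y hy => ?_))
  · by_cases hA : altSat (fun idx => ∃ t, B z n idx t = true) e [m]
    -- A failed witness must contribute at most f(x), which one sufficiently large penalty ensures.
    · obtain ⟨j, hj⟩ := exists_nat_ge ((ratOf n : ℝ) - f x)
      refine iInf_le_of_le j ?_
      rw [if_pos hA, EReal.coe_le_coe_iff]
      push_cast
      linarith
    · refine iInf_le_of_le 0 ?_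
      rw [if_neg hA, EReal.coe_le_coe_iff]
      exact ((key n).2 ⟨m, hA⟩).le
  · obtain ⟨r, hr, hr'⟩ := EReal.exists_rat_btwn_of_lt hy
    obtain ⟨n, rfl⟩ := ratOf_surjective r
    obtain ⟨m, hm⟩ := (key n).1 (by exact_mod_cast hr')
    refine hr.trans_le (le_iSup_of_le n (le_iSup_of_le m (le_iInf fun j => ?_)))
    rw [if_neg hm]

end Mem

end HyperSemi

theorem mainTheorem2 (D : ℕ) (X : Set (EuclideanSpace ℝ (Fin D)))
    (hX : HyperSemi.RecursivelyOpen X) :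
    -- the uniform characteristic function
    (∀ d : ℕ, 1 ≤ d →
      HyperSemi.IsComputableFun
        (HyperSemi.Rep.prod (HyperSemi.sigmaRep X d) (HyperSemi.rho X))
        (HyperSemi.rhoLower (d - 1))
        (fun Sx : Set X × X => Set.indicator Sx.1 (fun _ => (1 : ℝ)) Sx.2)) ∧
    -- the apply operator
    (∀ d : ℕ,
      HyperSemi.IsComputableFun
        (HyperSemi.Rep.prod (HyperSemi.semiRep X d) (HyperSemi.rho X))
        (HyperSemi.rhoLower d)
        (fun fx : {f : X → ℝ // HyperSemi.LowerSemimeasurable (d + 1) f} × X =>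
          fx.1.1 fx.2)) ∧
    -- continuous functions are lowersemimeasurable
    (∀ (d : ℕ) (f : X → ℝ),
      HyperSemi.IsContinuousFun (HyperSemi.rho X) (HyperSemi.rhoLower d) f →
        HyperSemi.LowerSemimeasurable (d + 1) f) ∧
    -- computable functions are effectively lowersemimeasurable
    (∀ (d : ℕ) (f : X → ℝ),
      HyperSemi.IsComputableFun (HyperSemi.rho X) (HyperSemi.rhoLower d) f →
        HyperSemi.EffectivelyLowerSemimeasurable (d + 1) f) ∧
    -- uniformly in a name of a realization
    (∀ d : ℕ,
      HyperSemi.IsComputableFun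
        (HyperSemi.Rep.prod
          (HyperSemi.realizerRep (HyperSemi.rho X) (HyperSemi.rhoLower d))
          HyperSemi.rhoUpper)
        (HyperSemi.sigmaRep X (d + 1))
        (fun fy : (X → ℝ) × ℝ => fy.1 ⁻¹' Set.Ioi fy.2)) := by
  obtain ⟨pX, hpX, hp⟩ := hX
  have hcov := HyperSemi.covers_of_thetaLower hp
  refine ⟨fun d hd => ?_, fun d => ?_, fun d f hf => ?_,
    fun d f hf => HyperSemi.effectivelyLowerSemimeasurable hpX hcov hf,
    HyperSemi.isComputableFun_superlevel hpX hcov⟩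
  · obtain ⟨e, rfl⟩ := Nat.exists_eq_add_of_le' hd
    exact HyperSemi.isComputableFun_indicator X e
  · cases d with
    | zero => exact HyperSemi.isComputableFun_apply_zero X
    | succ e => exact HyperSemi.isComputableFun_apply_succ X e
  · obtain ⟨sim, hsim⟩ := HyperSemi.exists_simulates hf
    exact HyperSemi.lowerSemimeasurable_of_simulates hcov hsim
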